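/- Let $P$ be a finite geometric lattice (an atomic lattice in which any two distinct elements covering a common element are both covered by some element), with minimum $\hat 0$, maximum $\hat 1$, rank function $\mathrm{rk}$ and atoms totally ordered as $a_1<a_2<\dots<a_m$. For $x\in P$ let $A(x)$ be the set of atoms below $x$; the minimal labeling of $P$ given by the atom ordering labels each cover $x\prec y$ with $\min(A(y)\setminus A(x))$. Let $S$ be a nonempty subset of $\{1,\dots,\mathrm{rk}(\hat 1)-1\}$ and put $T=S\setminus\{\max S\}=\{t_1<\dots<t_k\}$. The rank-selected Whitney homology of $P$ is $$W\!H_S(P)=\bigoplus_{u\in P,\ \mathrm{rk}(u)=\max S}\tilde H_*\big((\hat 0,u)^S\big),$$ where $(\hat 0,u)^S=\{x\in P:\hat 0<x<u,\ \mathrm{rk}(x)\in S\}$ and $\tilde H_*$ is the total reduced simplicial homology (in all dimensions, with complex coefficients) of the order complex. Let $u\in P$ have rank $n=\max S$. An $N\!BC^+$ basis of $[\hat 0,u]$ is a sequence $(w_1,\dots,w_n)$ of distinct atoms below $u$ such that $\mathrm{rk}(w_1\vee\dots\vee w_n)=n$; every atom below $w_1\vee\dots\vee w_n$ that is not one of the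 $w_i$ comes later in the atom ordering than at least one $w_i$; and $w_i=\min\big(A(w_1\vee\dots\vee w_i)\setminus A(w_1\vee\dots\vee w_{i-1})\big)$ for every $i$. Let $R$ be the ribbon with row lengths $t_1,t_2-t_1,\dots,n-t_k$ from bottom to top, with its boxes numbered $1,\dots,n$ from left to right and bottom to top; so box $i+1$ is directly above box $i$ if $i\in T$, and directly to the right of it otherwise. A standard $N\!BC^+$ filling $F$ of $R$ puts the entries $w_1,\dots,w_n$ of an $N\!BC^+$ basis of $[\hat 0,u]$ into the boxes $1,\dots,n$ in such a way that the entries increase from left to right in each row and from top to bottom in each column. For a filling $G$ by atoms $g_1,\dots,g_n$ let $\{G\}$ be its tabloid (the filling up to the order of the entries within each row), and let $\bar f(\{G\})$ be the chain $$g_1\vee\dots\vee g_{t_1}\;<\;g_1\vee\dots\vee g_{t_2}\;<\;\dots\;<\;g_1\vee\dots\vee g_{t_k}.$$ Extend $\bar f$ linearly and put $$\bar f(v_F)=\sum_{\sigma}\mathrm{sgn}(\sigma)\,\bar f(\{\sigma F\}),$$ the sum being over all permutations $\sigma$ that permute the entries of $F$ within each column. Then every $\bar f(v_F)$ is a cycle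 of the order complex of $(\hat 0,u)^S$, and the homology classes of the $\bar f(v_F)$, in the summands of $W\!H_S(P)$ belonging to $u$, as $u$ runs over all elements of rank $\max S$ and $F$ over all standard $N\!BC^+$ fillings for $u$ (distinct pairs $(u,F)$ giving distinct classes), form a basis of $W\!H_S(P)$ over $\mathbb C$. -/

import Mathlib

open scoped DirectSum

namespace RibbonBasis

noncomputable section

/-! ### Reduced simplicial homology of order complexes, over a field `𝕜` -/

/-- Formal `𝕜`-linear combinations of `k`-tuples of elements of `P`. -/
abbrev Tuples (𝕜 : Type*) [Field 𝕜] (P : Type*) (k : ℕ) : Type _ := (Fin k → P) →₀ 𝕜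

/-- The `𝕜`-vector space with basis the chains `x₀ < x₁ < ⋯ < x_{k-1}` of `k` elements of `A`.
These chains are the `(k-1)`-dimensional faces of the order complex of the poset `A`;
for `k = 0` there is exactly one of them, the empty chain. -/
def chains (𝕜 : Type*) [Field 𝕜] {P : Type*} [PartialOrder P] (A : Set P) (k : ℕ) :
    Submodule 𝕜 (Tuples 𝕜 P k) :=
  Finsupp.supported 𝕜 𝕜 {c : Fin k → P | StrictMono c ∧ ∀ i, c i ∈ A}

/-- The simplicial boundary map, `c ↦ ∑ i, (-1) ^ i • (c with its i-th entry deleted)`, where the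
entries are numbered from `0`. -/
def boundary (𝕜 : Type*) [Field 𝕜] (P : Type*) (k : ℕ) :
    Tuples 𝕜 P (k + 1) →ₗ[𝕜] Tuples 𝕜 P k :=
  Finsupp.linearCombination 𝕜 fun c : Fin (k + 1) → P =>
    ∑ i : Fin (k + 1), Finsupp.single (i.removeNth c) ((-1 : 𝕜) ^ (i : ℕ))

/-- The cycles in the augmented chain complex of the order complex of `A`. Multiples of the empty
chain (`k = 0`) all are cycles. -/
def cycles (𝕜 : Type*) [Field 𝕜] {P : Type*} [PartialOrder P] (A : Set P) :
    (k : ℕ) → Submodule 𝕜 (Tuples 𝕜 P k)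
  | 0 => chains 𝕜 A 0
  | k + 1 => chains 𝕜 A (k + 1) ⊓ LinearMap.ker (boundary 𝕜 P k)

/-- The boundaries in the augmented chain complex of the order complex of `A`. -/
def boundaries (𝕜 : Type*) [Field 𝕜] {P : Type*} [PartialOrder P] (A : Set P) (k : ℕ) :
    Submodule 𝕜 (Tuples 𝕜 P k) :=
  (chains 𝕜 A (k + 1)).map (boundary 𝕜 P k)

/-- The reduced simplicial homology of the order complex of `A`: cycles modulo boundaries, as the
space of all residue classes of cycles in the quotient by the subspace of boundaries.
The index `k` counts the elements of a chain, so this is the reduced homology in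
dimension `k - 1`. -/
abbrev ReducedHomology (𝕜 : Type*) [Field 𝕜] {P : Type*} [PartialOrder P] (A : Set P) (k : ℕ) :
    Type _ :=
  (cycles 𝕜 A k).map (boundaries 𝕜 A k).mkQ

/-- The homology class of a cycle. -/
def homologyClass {𝕜 : Type*} [Field 𝕜] {P : Type*} [PartialOrder P] {A : Set P} {k : ℕ}
    (z : Tuples 𝕜 P k) (hz : z ∈ cycles 𝕜 A k) : ReducedHomology 𝕜 A k :=
  ⟨(boundaries 𝕜 A k).mkQ z, Submodule.mem_map_of_mem hz⟩

/-! ### Ranks and rank-selected Whitney homology -/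

/-- The rank of an element of a finite poset: the largest length of a chain ending at it. -/
def rank {P : Type*} [PartialOrder P] (x : P) : ℕ := (Order.height x).toNat

/-- The open interval `(⊥, u)` of the subposet of the elements whose ranks lie in `S`. -/
def openInterval {P : Type*} [PartialOrder P] [OrderBot P] (S : Finset ℕ) (u : P) : Set P :=
  {x | ⊥ < x ∧ x < u ∧ rank x ∈ S}

/-- The elements whose rank is `max S`. -/
abbrev TopElements (P : Type*) [PartialOrder P] (S : Finset ℕ) (hS : S.Nonempty) : Type _ :=
  {u : P // rank u = S.max' hS}

/-- Rank-selected Whitney homology: the direct sum, over all elements `u` of rank `max S`, of the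
reduced homology (in all dimensions) of the interval from `⊥` to `u` of the rank-selected
subposet. -/
abbrev WhitneyHomology (𝕜 : Type*) [Field 𝕜] (P : Type*) [PartialOrder P] [OrderBot P]
    (S : Finset ℕ) (hS : S.Nonempty) : Type _ :=
  ⨁ u : TopElements P S hS, ⨁ k : ℕ, ReducedHomology 𝕜 (openInterval S u.1) k

open Classical in
/-- The class in Whitney homology of a cycle `z` in the open interval below `u`. -/
def whitneyClass {𝕜 : Type*} [Field 𝕜] {P : Type*} [PartialOrder P] [OrderBot P] (S : Finset ℕ)
    (hS : S.Nonempty) (u : TopElements P S hS) (k : ℕ) (z : Tuples 𝕜 P k)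
    (hz : z ∈ cycles 𝕜 (openInterval S u.1) k) : WhitneyHomology 𝕜 P S hS :=
  DirectSum.lof 𝕜 (TopElements P S hS)
    (fun u => ⨁ k : ℕ, ReducedHomology 𝕜 (openInterval S u.1) k) u
    (DirectSum.lof 𝕜 ℕ (fun k => ReducedHomology 𝕜 (openInterval S u.1) k) k
      (homologyClass z hz))

/-! ### Minimal labelings and NBC⁺ bases

A total order `a₀ < a₁ < ⋯ < a_{m-1}` on the atoms of `P` is given as an enumeration
`a : Fin m ≃ {x : P // IsAtom x}`. The atom `a j` is referred to by its position `j`. -/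

section Atoms

variable {P : Type*} [Lattice P] [BoundedOrder P] {m : ℕ}

/-- `A(x)`: the atoms below `x`. -/
def atomsBelow (a : Fin m ≃ {x : P // IsAtom x}) (x : P) : Set (Fin m) :=
  {j | (a j : P) ≤ x}

/-- `j` is the least atom that is below `y` and not below `x`. For `x ⋖ y` this `j` is the label of
the covering relation in the minimal labeling given by the atom ordering `a`. -/
def IsMinLabel (a : Fin m ≃ {x : P // IsAtom x}) (x y : P) (j : Fin m) : Prop :=
  IsLeast (atomsBelow a y \ atomsBelow a x) j

/-- The join of a finite set of atoms. -/
def join (a : Fin m ≃ {x : P // IsAtom x}) (s : Finset (Fin m)) : P :=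
  s.sup fun j => (a j : P)

/-- NBC independent sets of atoms: the rank of the join is the size of the set, and every atom
below the join and outside the set comes later than at least one element of the set. -/
structure IsNBCIndependent (a : Fin m ≃ {x : P // IsAtom x}) (s : Finset (Fin m)) : Prop where
  rank_join : rank (join a s) = s.card
  exists_lt : ∀ j ∉ s, (a j : P) ≤ join a s → ∃ i ∈ s, i < j

/-- NBC⁺ bases of the geometric lattice `[⊥, u]`, whose atoms are the atoms of `P` below `u`:
ordered NBC independent sets `(w 0, w 1, …)` of `rank u` atoms below `u` such that each `w k` is
the least atom that is below the join of `w 0, …, w k` and not below that of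
`w 0, …, w (k - 1)`. -/
structure IsNBCPlusBasis (a : Fin m ≃ {x : P // IsAtom x}) (u : P)
    (w : Fin (rank u) → Fin m) : Prop where
  injective : Function.Injective w
  le : ∀ k, (a (w k) : P) ≤ u
  nbc : IsNBCIndependent a (Finset.univ.image w)
  least : ∀ k, IsMinLabel a (join a ((Finset.Iio k).image w)) (join a ((Finset.Iic k).image w))
    (w k)

end Atoms

/-! ### Ribbons

For `T = {t₁ < ⋯ < t_r} ⊆ {1, …, n - 1}`, the boxes of the ribbon with row lengths
`t₁, t₂ - t₁, …, n - t_r` (from bottom to top) are numbered `0, 1, …, n - 1` from left to right and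
bottom to top. So box `j` lies directly above box `j - 1` if `j ∈ T`, and directly to the right of
it if `j ∉ T`. A filling is given by its reading word. -/

/-- The row of box `i`, where rows are numbered `0, 1, …` from bottom to top. -/
def ribbonRow (T : Finset ℕ) (i : ℕ) : ℕ := ((Finset.Icc 1 i).filter (· ∈ T)).card

/-- The column of box `i`, where columns are numbered `0, 1, …` from left to right. -/
def ribbonCol (T : Finset ℕ) (i : ℕ) : ℕ := ((Finset.Icc 1 i).filter (· ∉ T)).card

/-- Standard fillings: the entries increase from left to right in each row and from top to bottom
in each column. Of two boxes in the same column, the one with the larger number is the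
upper one. -/
structure IsStandardFilling (T : Finset ℕ) {n m : ℕ} (w : Fin n → Fin m) : Prop where
  row_lt : ∀ i j : Fin n, i < j → ribbonRow T i = ribbonRow T j → w i < w j
  col_lt : ∀ i j : Fin n, i < j → ribbonCol T i = ribbonCol T j → w j < w i

/-- The tabloid of a filling, which remembers the set of the entries of each row. -/
def tabloid (T : Finset ℕ) {n m : ℕ} (w : Fin n → Fin m) : ℕ → Finset (Fin m) := fun r =>
  (Finset.univ.filter fun i : Fin n => ribbonRow T i = r).image w

/-- The polytabloid of a filling: the signed sum of the tabloids obtained by permuting the entries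
within the columns. -/
def polytabloid (𝕜 : Type*) [Field 𝕜] (T : Finset ℕ) {n m : ℕ} (w : Fin n → Fin m) :
    (ℕ → Finset (Fin m)) →₀ 𝕜 :=
  ∑ σ : Equiv.Perm (Fin n) with ∀ i : Fin n, ribbonCol T (σ i) = ribbonCol T i,
    Finsupp.single (tabloid T (w ∘ σ)) ((Equiv.Perm.sign σ : ℤ) : 𝕜)

section Fillings

variable {P : Type*} [Lattice P] [BoundedOrder P] {m : ℕ}

/-- The map from tabloids to chains: the `l`-th entry of the chain is the join of all atoms in the
rows `0, …, l` of the tabloid (the topmost row of the ribbon is not used). -/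
def chainOfTabloid (a : Fin m ≃ {x : P // IsAtom x}) (k : ℕ) (t : ℕ → Finset (Fin m)) :
    Fin k → P :=
  fun l => (Finset.range (l + 1)).sup fun r => join a (t r)

/-- The image of the polytabloid of a filling under the linear extension of `chainOfTabloid`.
The ribbon has `#T + 1` rows, and the chains have `#T` elements. -/
def ribbonElement (𝕜 : Type*) [Field 𝕜] (a : Fin m ≃ {x : P // IsAtom x}) (T : Finset ℕ) {n : ℕ}
    (w : Fin n → Fin m) : Tuples 𝕜 P T.card :=
  Finsupp.lmapDomain 𝕜 𝕜 (chainOfTabloid a T.card) (polytabloid 𝕜 T w)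

/-- The standard fillings, with NBC⁺ bases of `[⊥, u]`, of the ribbon with `rank u` boxes given
by `T`. -/
abbrev StandardNBCPlusFilling (a : Fin m ≃ {x : P // IsAtom x}) (T : Finset ℕ) (u : P) : Type :=
  {w : Fin (rank u) → Fin m // IsNBCPlusBasis a u w ∧ IsStandardFilling T w}

end Fillings

end

end RibbonBasis

open RibbonBasis

/-! By `isNBCPlusBasis_iff`, the NBC⁺ bases of `[⊥, u]` are exactly the label words of the maximal
chains of `[⊥, u]`, and by `isStandardFilling_iff` such a word fills the ribbon of `T` in the
standard way exactly when its descent set is `T`. So the fillings are the label words with descent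
set `T`.

Attach to every chain `c` of the rank-selected interval the lexicographically least label word `ω c`
of a maximal chain through `c`. Two facts about these words carry the proof. Every descent of `ω c`
is a rank of `c`, since undoing a descent changes only the element at that rank and gives a smaller
word (`IsLeastWord.exists_rank_eq`). Conversely, a label word is least among those whose maximal
chains agree with its own at all of its descents (`IsLabelWord.toLex_le`). Hence the chains with `ω
c = w` correspond to the rank sets between the descent set of `w` and `T`.

If some `t ∈ T` is not a descent of `w`, adding or removing the element of rank `t` matches these
chains in pairs: the larger chain is never the leading chain of a cycle, and the smaller one is the
leading chain of a boundary. If the descent set is `T`, a single chain remains; it has `#T` elements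
and is the leading chain, with coefficient 1, of the ribbon element of `w`, because a nontrivial
column permutation of a standard filling makes the word smaller. Gaussian elimination
(`le_of_elimination`, applied in `cycles_le_of_leading`) then shows that every cycle is a boundary
if its chains do not have `#T` elements, and that ribbon elements span the cycles in the remaining
degree, where no nonzero boundaries exist. Distinct leading chains give linear independence. The
argument works over every field. -/

namespace RibbonBasis

/-! ### Ranks in finite semimodular lattices -/

section Rank

/-- `IsSaturated x y l`: there is a saturated chain of length `l` from `x` to `y`. -/
inductive IsSaturated {P : Type*} [Preorder P] : P → P → ℕ → Prop
  | refl (x : P) : IsSaturated x x 0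
  | step {x y z : P} {l : ℕ} : x ⋖ y → IsSaturated y z l → IsSaturated x z (l + 1)

theorem IsSaturated.trans {P : Type*} [Preorder P] {x y z : P} {k l : ℕ}
    (h : IsSaturated x y k) (h' : IsSaturated y z l) : IsSaturated x z (k + l) := by
  induction h with
  | refl => simpa using h'
  | step hc _ ih => rw [Nat.add_right_comm]; exact .step hc (ih h')

theorem IsSaturated.le {P : Type*} [Preorder P] {x y : P} {l : ℕ} (h : IsSaturated x y l) :
    x ≤ y := by
  induction h with
  | refl => exact le_rfl
  | step hc _ ih => exact hc.le.trans ih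

theorem exists_isSaturated {P : Type*} [PartialOrder P] [Finite P] {x y : P} (h : x ≤ y) :
    ∃ l, IsSaturated x y l := by
  induction x using WellFoundedGT.induction with
  | ind x ih =>
    rcases h.eq_or_lt with rfl | h
    · exact ⟨0, .refl _⟩
    · obtain ⟨z, hxz, hzy⟩ := exists_covBy_le_of_lt h
      obtain ⟨l, hl⟩ := ih z hxz.lt hzy
      exact ⟨l + 1, .step hxz hl⟩

theorem height_ne_top {P : Type*} [PartialOrder P] [Finite P] (x : P) : Order.height x ≠ ⊤ := by
  rw [Ne, Order.height_eq_top_iff]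
  intro h
  obtain ⟨p, -, hp⟩ := h (Nat.card P)
  have := Fintype.ofFinite P
  have := p.length_lt_card
  rw [hp, Nat.card_eq_fintype_card] at this
  exact lt_irrefl _ this

theorem rank_strictMono {P : Type*} [PartialOrder P] [Finite P] : StrictMono (rank : P → ℕ) := fun x y h => by
  have := Order.height_strictMono h (height_ne_top x).lt_top
  rwa [← ENat.natCast_toNat (height_ne_top x), ← ENat.natCast_toNat (height_ne_top y),
    Nat.cast_lt] at this

@[simp]
theorem rank_bot {P : Type*} [PartialOrder P] [OrderBot P] : rank (⊥ : P) = 0 := by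
  simp [rank]

variable {P : Type*} [Lattice P] [Finite P] [IsWeakUpperModularLattice P]

/-- Jordan–Dedekind: if two saturated chains start with different covers of `x`, semimodularity
makes the join of these cover both, and a saturated chain from this join to `y` can be compared with
each of the two tails. -/
theorem IsSaturated.length_unique {x y : P} {k : ℕ} (h : IsSaturated x y k) :
    ∀ {l : ℕ}, IsSaturated x y l → k = l := by
  induction k generalizing x with
  | zero =>
    intro l h'
    cases h
    cases h' with
    | refl => rfl
    | step hc h' => exact absurd (hc.lt.trans_le h'.le) (lt_irrefl _)
  | succ k ih =>
    intro l h'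
    cases h with
    | step hc h =>
    rename_i x₁
    cases h' with
    | refl => exact absurd (hc.lt.trans_le h.le) (lt_irrefl _)
    | step hc' h' =>
      rename_i y₁ l
      by_cases hxy : x₁ = y₁
      · subst hxy
        rw [ih h h']
      · have hinf : x₁ ⊓ y₁ = x := by
          rcases hc.eq_or_eq (le_inf hc.le hc'.le) inf_le_left with h₁ | h₁
          · exact h₁
          · rcases hc'.eq_or_eq hc.le (inf_eq_left.1 h₁) with h₂ | h₂
            · exact absurd h₂ hc.lt.ne'
            · exact absurd h₂ hxy
        have h₁ : x₁ ⋖ x₁ ⊔ y₁ := covBy_sup_of_inf_covBy_of_inf_covBy_left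
          (by rwa [hinf]) (by rwa [hinf])
        have h₂ : y₁ ⋖ x₁ ⊔ y₁ := covBy_sup_of_inf_covBy_of_inf_covBy_right
          (by rwa [hinf]) (by rwa [hinf])
        obtain ⟨p, hp⟩ := exists_isSaturated (sup_le h.le h'.le)
        have e₁ := ih h (.step h₁ hp)
        subst e₁
        rw [ih (.step h₂ hp) h']

/-- Connects `rank`, a supremum over all chains, with the common length of the saturated chains;
this makes the rank go up by exactly one along covers. -/
theorem isSaturated_bot_iff [BoundedOrder P] {x : P} {l : ℕ} : IsSaturated ⊥ x l ↔ rank x = l := by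
  choose ρ hρ using fun x : P => exists_isSaturated (bot_le (a := x))
  have hmono : StrictMono ρ := by
    intro x y h
    obtain ⟨l, hl⟩ := exists_isSaturated h.le
    have := (hρ y).length_unique ((hρ x).trans hl)
    have : l ≠ 0 := by
      rintro rfl
      cases hl
      exact lt_irrefl _ h
    omega
  have key : Order.height x = ρ x := by
    refine le_antisymm ?_ ?_
    · simpa using Order.height_le_height_apply_of_strictMono ρ hmono x
    · induction x using WellFoundedLT.induction with
      | ind x ih =>
        rcases eq_or_ne x ⊥ with rfl | hx
        · rw [(hρ ⊥).length_unique (.refl ⊥)]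
          simp
        · obtain ⟨y, -, hy⟩ := exists_le_covBy_of_lt hx.bot_lt
          rw [(hρ x).length_unique ((hρ y).trans (.step hy (.refl x)))]
          exact le_trans (by simpa using add_le_add_left (ih y hy.lt) 1)
            (Order.height_add_one_le hy.lt)
  have : rank x = ρ x := by rw [rank, key]; rfl
  rw [this]
  exact ⟨fun h => (hρ x).length_unique h, fun h => h ▸ hρ x⟩

variable [BoundedOrder P]

theorem rank_eq_of_covBy {x y : P} (h : x ⋖ y) : rank y = rank x + 1 :=
  isSaturated_bot_iff.1 ((isSaturated_bot_iff.2 rfl).trans (.step h (.refl y)))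

theorem covBy_sup_of_isAtom {x b : P} (hb : IsAtom b) (h : ¬ b ≤ x) : x ⋖ x ⊔ b := by
  induction x using WellFoundedLT.induction with
  | ind x ih =>
    rcases eq_or_ne x ⊥ with rfl | hx
    · simpa using hb.bot_covBy
    · obtain ⟨y, -, hy⟩ := exists_le_covBy_of_lt hx.bot_lt
      have hyb := ih y hy.lt fun h' => h (h'.trans hy.le)
      have hinf : x ⊓ (y ⊔ b) = y := by
        rcases hy.eq_or_eq (le_inf hy.le le_sup_left) inf_le_left with h₁ | h₁
        · exact h₁
        · rcases hyb.eq_or_eq hy.le (inf_eq_left.1 h₁) with h₂ | h₂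
          · exact absurd h₂ hy.lt.ne'
          · exact absurd (h₂ ▸ le_sup_right) h
      have := covBy_sup_of_inf_covBy_of_inf_covBy_left (a := x) (b := y ⊔ b)
        (by rwa [hinf]) (by rwa [hinf])
      rwa [← sup_assoc, sup_eq_left.2 hy.le] at this

theorem rank_sup_isAtom {x b : P} (hb : IsAtom b) (h : ¬ b ≤ x) : rank (x ⊔ b) = rank x + 1 :=
  rank_eq_of_covBy (covBy_sup_of_isAtom hb h)

theorem rank_sup_isAtom_le {x b : P} (hb : IsAtom b) : rank (x ⊔ b) ≤ rank x + 1 := by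
  by_cases h : b ≤ x
  · simp [sup_eq_left.2 h]
  · exact (rank_sup_isAtom hb h).le

end Rank

/-! ### Words of atoms and label words of maximal chains -/

section Words

variable {P : Type*} [Lattice P] [BoundedOrder P] {m n : ℕ} (a : Fin m ≃ {x : P // IsAtom x})

/-- The join of the first `i` atoms of a word. -/
noncomputable def initialJoin (w : Fin n → Fin m) (i : ℕ) : P :=
  join a ((Finset.univ.filter fun j : Fin n => (j : ℕ) < i).image w)

/-- The words of atoms for which the joins of the first `0, 1, …` atoms are strictly
increasing. -/
def IsIndependentWord (w : Fin n → Fin m) : Prop :=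
  ∀ i : Fin n, ¬ (a (w i) : P) ≤ initialJoin a w i

/-- The label words, with respect to the minimal labeling, of the maximal chains of `[⊥, u]`. -/
structure IsLabelWord (u : P) (w : Fin n → Fin m) : Prop where
  le : ∀ i, (a (w i) : P) ≤ u
  least : ∀ i : Fin n, IsMinLabel a (initialJoin a w i) (initialJoin a w (i + 1)) (w i)

/-- `t` is a descent of `w` if the `t`-th letter of `w` (counted from `1`) is larger than the
next one. -/
def IsDescent (w : Fin n → Fin m) (t : ℕ) : Prop :=
  ∃ i j : Fin n, (i : ℕ) + 1 = j ∧ (j : ℕ) = t ∧ w j < w i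

variable {a} {w v : Fin n → Fin m} {u : P}

theorem join_le_iff {s : Finset (Fin m)} {y : P} : join a s ≤ y ↔ ∀ j ∈ s, (a j : P) ≤ y := by
  simp [join]

theorem initialJoin_le_iff {i : ℕ} {y : P} :
    initialJoin a w i ≤ y ↔ ∀ j : Fin n, (j : ℕ) < i → (a (w j) : P) ≤ y := by
  simp [initialJoin, join_le_iff]

theorem le_initialJoin {i : ℕ} {j : Fin n} (h : (j : ℕ) < i) :
    (a (w j) : P) ≤ initialJoin a w i :=
  initialJoin_le_iff.1 le_rfl j h

@[simp]
theorem initialJoin_zero : initialJoin a w 0 = ⊥ :=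
  le_bot_iff.1 (initialJoin_le_iff.2 fun _ h => absurd h (Nat.not_lt_zero _))

theorem initialJoin_succ (i : Fin n) :
    initialJoin a w (i + 1) = initialJoin a w i ⊔ (a (w i) : P) := by
  refine le_antisymm (initialJoin_le_iff.2 fun j hj => ?_)
    (sup_le (initialJoin_le_iff.2 fun j hj => le_initialJoin (by omega))
      (le_initialJoin (by omega)))
  rcases Nat.lt_succ_iff_lt_or_eq.1 hj with h | h
  · exact (le_initialJoin h).trans le_sup_left
  · rw [Fin.ext h]
    exact le_sup_right

theorem initialJoin_mono : Monotone (initialJoin a w) := fun _ _ h =>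
  initialJoin_le_iff.2 fun _ hj => le_initialJoin (hj.trans_le h)

theorem initialJoin_congr {i : ℕ} (h : ∀ j : Fin n, (j : ℕ) < i → v j = w j) :
    initialJoin a v i = initialJoin a w i :=
  le_antisymm (initialJoin_le_iff.2 fun j hj => h j hj ▸ le_initialJoin hj)
    (initialJoin_le_iff.2 fun j hj => h j hj ▸ le_initialJoin hj)

theorem initialJoin_comp_perm {i : ℕ} {σ : Equiv.Perm (Fin n)}
    (h : ∀ j : Fin n, (σ j : ℕ) < i ↔ (j : ℕ) < i) :
    initialJoin a (w ∘ σ) i = initialJoin a w i := by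
  refine le_antisymm (initialJoin_le_iff.2 fun j hj => le_initialJoin ((h j).2 hj))
    (initialJoin_le_iff.2 fun j hj => ?_)
  have := le_initialJoin (a := a) (w := w ∘ σ) (j := σ.symm j) ((h _).1 (by simpa using hj))
  simpa using this

theorem IsLabelWord.independent (h : IsLabelWord a u w) : IsIndependentWord a w :=
  fun i => (h.least i).1.2

theorem IsIndependentWord.injective (h : IsIndependentWord a w) : Function.Injective w := by
  intro i j hij
  by_contra hne
  rcases lt_or_gt_of_ne hne with hlt | hlt
  · exact h j (hij ▸ le_initialJoin hlt)
  · exact h i (hij ▸ le_initialJoin hlt)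

/-- At the step `q` where `j` first comes below the initial join, `j` competes for the minimal
label, so `w q ≤ j`. -/
theorem IsLabelWord.exists_le (h : IsLabelWord a u w) {s t : ℕ} {j : Fin m}
    (hs : ¬ (a j : P) ≤ initialJoin a w s) (ht : (a j : P) ≤ initialJoin a w t) (htn : t ≤ n) :
    ∃ q : Fin n, s ≤ q ∧ (q : ℕ) < t ∧ w q ≤ j := by
  induction t with
  | zero =>
    rw [initialJoin_zero] at ht
    exact absurd (ht.trans bot_le) hs
  | succ t ih =>
    by_cases ht' : (a j : P) ≤ initialJoin a w t
    · obtain ⟨q, h₁, h₂, h₃⟩ := ih ht' (by omega)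
      exact ⟨q, h₁, by omega, h₃⟩
    · refine ⟨⟨t, htn⟩, ?_, Nat.lt_succ_self t, (h.least ⟨t, htn⟩).2 ⟨ht, ht'⟩⟩
      by_contra hst
      exact hs (ht.trans (initialJoin_mono (by simp only [not_le] at hst; omega)))

/-- Between consecutive positions of `U` the word `w` rises. At the first difference `p` with `v p <
w p`, the atom `v p` is below the next common element, so some letter of `w` in this rising stretch
is at most `v p`; but all these letters are at least `w p`. -/
theorem IsLabelWord.toLex_le (hw : IsLabelWord a u w) (hv : IsLabelWord a u v)
    (hn : initialJoin a w n = u) {U : Set ℕ} (hU : ∀ t, IsDescent w t → t ∈ U)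
    (h : ∀ t ∈ U, t ≤ n → initialJoin a v t = initialJoin a w t) : toLex w ≤ toLex v := by
  by_contra hlt
  obtain ⟨p, hp, hlt⟩ : ∃ p, (∀ j < p, v j = w j) ∧ v p < w p := not_le.1 hlt
  -- The next position after `p` at which the two maximal chains are known to agree; at `n` the
  -- chain of `w` has reached `u`.
  have hex : ∃ t, (p : ℕ) < t ∧ (t ∈ U ∨ t = n) := ⟨n, p.2, Or.inr rfl⟩
  classical
  set t := Nat.find hex with ht
  obtain ⟨hpt, htU⟩ := Nat.find_spec hex
  rw [← ht] at hpt htU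
  have htn : t ≤ n := Nat.find_min' hex ⟨p.2, Or.inr rfl⟩
  have hjp : initialJoin a v p = initialJoin a w p := initialJoin_congr fun j hj => hp j hj
  have hle : (a (v p) : P) ≤ initialJoin a w t := by
    rcases htU with h' | h'
    · exact h t h' htn ▸ le_initialJoin hpt
    · rw [h', hn]
      exact hv.le p
  obtain ⟨q, hpq, hqt, hq⟩ := hw.exists_le (hjp ▸ hv.independent p) hle htn
  have hrise : ∀ r, ∀ hr : r < t, (p : ℕ) ≤ r → w p ≤ w ⟨r, hr.trans_le htn⟩ := by
    intro r hr hpr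
    induction r, hpr using Nat.le_induction with
    | base => exact le_rfl
    | succ r hpr ih =>
      refine (ih (by omega)).trans (not_lt.1 fun hdes => ?_)
      exact Nat.find_min hex hr ⟨by omega, Or.inl (hU _ ⟨_, _, rfl, rfl, hdes⟩)⟩
  exact absurd (hlt.trans_le (hrise q hqt hpq)) (not_lt.2 hq)

variable [Finite P] [IsWeakUpperModularLattice P]

theorem IsIndependentWord.rank_initialJoin (h : IsIndependentWord a w) {i : ℕ} (hi : i ≤ n) :
    rank (initialJoin a w i) = i := by
  induction i with
  | zero => simp
  | succ i ih =>
    have := initialJoin_succ (a := a) (w := w) ⟨i, hi⟩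
    rw [this, rank_sup_isAtom (a _).2 (h ⟨i, hi⟩), ih (by omega)]

theorem IsIndependentWord.initialJoin_eq (h : IsIndependentWord a w) (hu : rank u = n)
    (hle : ∀ i, (a (w i) : P) ≤ u) : initialJoin a w n = u := by
  by_contra hne
  have := rank_strictMono (lt_of_le_of_ne (initialJoin_le_iff.2 fun i _ => hle i) hne)
  rw [h.rank_initialJoin le_rfl, hu] at this
  exact lt_irrefl _ this

/-- Each letter raises the rank by at most one, so a single redundant letter leaves the total below
`n`. Independence thus depends only on the join of all letters and survives permutation of the word.
-/
theorem isIndependentWord_of_rank (h : rank (initialJoin a w n) = n) : IsIndependentWord a w := by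
  intro p hp
  have key : ∀ i, i ≤ n → rank (initialJoin a w i) ≤ i ∧
      ((p : ℕ) < i → rank (initialJoin a w i) < i) := by
    intro i
    induction i with
    | zero => simp
    | succ i ih =>
      intro hi
      have hsucc := initialJoin_succ (a := a) (w := w) ⟨i, hi⟩
      have hle := rank_sup_isAtom_le (x := initialJoin a w i) (a (w ⟨i, hi⟩)).2
      obtain ⟨h₁, h₂⟩ := ih (by omega)
      simp only at hsucc
      refine ⟨by rw [hsucc]; omega, fun hpi => ?_⟩
      rcases Nat.lt_succ_iff_lt_or_eq.1 hpi with h' | h'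
      · rw [hsucc]
        have := h₂ h'
        omega
      · obtain rfl : p = ⟨i, hi⟩ := Fin.ext h'
        have hsup := sup_eq_left.2 hp
        simp only at hsup
        rw [hsucc, hsup]
        omega
  exact absurd h ((key n le_rfl).2 p.2).ne

theorem IsIndependentWord.comp_perm (h : IsIndependentWord a w) (σ : Equiv.Perm (Fin n)) :
    IsIndependentWord a (w ∘ σ) :=
  isIndependentWord_of_rank <| by
    rw [initialJoin_comp_perm fun j => by simp, h.rank_initialJoin le_rfl]

/-- Replacing each letter by the minimal label of the cover that it produces keeps the maximal chain
and can only decrease letters. This turns rearranged words into label words that are no larger. -/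
theorem IsIndependentWord.exists_isLabelWord (h : IsIndependentWord a v)
    (hle : ∀ i, (a (v i) : P) ≤ u) : ∃ w : Fin n → Fin m, IsLabelWord a u w ∧
      (∀ i ≤ n, initialJoin a w i = initialJoin a v i) ∧ ∀ i, w i ≤ v i := by
  have hex : ∀ i : Fin n, ∃ j, IsMinLabel a (initialJoin a v i) (initialJoin a v (i + 1)) j := by
    intro i
    obtain ⟨j, hj, hmin⟩ := Set.exists_min_image
      (atomsBelow a (initialJoin a v (i + 1)) \ atomsBelow a (initialJoin a v i)) id
      (Set.toFinite _) ⟨v i, le_initialJoin (Nat.lt_succ_self _), h i⟩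
    exact ⟨j, hj, hmin⟩
  choose w hw using hex
  have hJ : ∀ i ≤ n, initialJoin a w i = initialJoin a v i := by
    intro i
    induction i with
    | zero => simp
    | succ i ih =>
      intro hi
      have hwi := hw ⟨i, hi⟩
      have e₁ := initialJoin_succ (a := a) (w := w) ⟨i, hi⟩
      have e₂ := initialJoin_succ (a := a) (w := v) ⟨i, hi⟩
      simp only at e₁ e₂ hwi
      rw [e₁, ih (by omega)]
      have hcov := covBy_sup_of_isAtom (a (v ⟨i, hi⟩)).2 (h ⟨i, hi⟩)
      simp only at hcov
      rw [← e₂] at hcov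
      exact (hcov.eq_or_eq le_sup_left (sup_le hcov.le hwi.1.1)).resolve_left
        fun h' => hwi.1.2 (sup_eq_left.1 h')
  refine ⟨w, ⟨fun i => (hw i).1.1.trans (initialJoin_le_iff.2 fun j _ => hle j), fun i => ?_⟩, hJ,
    fun i => (hw i).2 ⟨le_initialJoin (Nat.lt_succ_self _), h i⟩⟩
  rw [hJ i i.2.le, hJ (i + 1) i.2]
  exact hw i

/-- The NBC condition is automatic for a label word: `IsLabelWord.exists_le` from position `0` gives
a letter at most any given atom below `u`. -/
theorem isNBCPlusBasis_iff {w : Fin (rank u) → Fin m} :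
    IsNBCPlusBasis a u w ↔ IsLabelWord a u w := by
  have e₁ : ∀ k : Fin (rank u), join a ((Finset.Iio k).image w) = initialJoin a w k := by
    intro k
    rw [initialJoin]
    congr 2
    ext j
    simp
  have e₂ : ∀ k : Fin (rank u), join a ((Finset.Iic k).image w) = initialJoin a w (k + 1) := by
    intro k
    rw [initialJoin]
    congr 2
    ext j
    simp
  refine ⟨fun h => ⟨h.le, fun k => ?_⟩, fun h => ?_⟩
  · have := h.least k
    rwa [e₁, e₂] at this
  · have hJ : join a (Finset.univ.image w) = initialJoin a w (rank u) := by
      rw [initialJoin]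
      congr 2
      ext j
      simp
    refine ⟨h.independent.injective, h.le, ⟨?_, fun j hj hle => ?_⟩, fun k => ?_⟩
    · rw [hJ, h.independent.rank_initialJoin le_rfl,
        Finset.card_image_of_injective _ h.independent.injective, Finset.card_univ,
        Fintype.card_fin]
    · rw [hJ] at hle
      obtain ⟨q, -, -, hq⟩ := h.exists_le (s := 0)
        (by rw [initialJoin_zero, le_bot_iff]; exact (a j).2.1) hle le_rfl
      refine ⟨w q, Finset.mem_image_of_mem _ (Finset.mem_univ _), lt_of_le_of_ne hq ?_⟩
      rintro rfl
      exact hj (Finset.mem_image_of_mem _ (Finset.mem_univ _))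
    · rw [e₁, e₂]
      exact h.least k

end Words

/-! ### Lexicographically least label words -/

section LeastWords

variable {P : Type*} [Lattice P] [BoundedOrder P] {m n k : ℕ} {a : Fin m ≃ {x : P // IsAtom x}}
  {w v : Fin n → Fin m} {u : P}

/-- The maximal chain with label word `w` contains the entries of `c`. -/
def PassesThrough (a : Fin m ≃ {x : P // IsAtom x}) (w : Fin n → Fin m) (c : Fin k → P) : Prop :=
  ∀ i, initialJoin a w (rank (c i)) = c i

/-- `w` is the lexicographically least label word of a maximal chain of `[⊥, u]` that contains the
entries of `c`. -/
structure IsLeastWord (a : Fin m ≃ {x : P // IsAtom x}) (u : P) (c : Fin k → P)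
    (w : Fin n → Fin m) : Prop where
  isLabelWord : IsLabelWord a u w
  passesThrough : PassesThrough a w c
  toLex_le : ∀ v : Fin n → Fin m, IsLabelWord a u v → PassesThrough a v c → toLex w ≤ toLex v

/-- Take an atom below the least element of `C` that is not below `x`; atomisticity provides one
that is not itself below `x`. -/
theorem exists_atom_comparable [Finite P] [IsAtomistic P] (a : Fin m ≃ {x : P // IsAtom x})
    {C : Set P} (hC : IsChain (· ≤ ·) C) {x : P} (hx : ∀ y ∈ C, y ≤ x ∨ x ≤ y)
    (hex : ∃ y ∈ C, ¬ y ≤ x) :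
    ∃ j, ¬ (a j : P) ≤ x ∧ ∀ y ∈ C, y ≤ x ⊔ a j ∨ x ⊔ a j ≤ y := by
  obtain ⟨y, ⟨hyC, hyx⟩, hmin⟩ :=
    (Set.toFinite {y | y ∈ C ∧ ¬ y ≤ x}).exists_minimal hex
  obtain ⟨b, hb, hby, hbx⟩ : ∃ b, IsAtom b ∧ b ≤ y ∧ ¬ b ≤ x := by
    by_contra! h
    exact hyx (le_iff_atom_le_imp.2 h)
  have hxy := (hx y hyC).resolve_left hyx
  refine ⟨a.symm ⟨b, hb⟩, by simpa using hbx, fun z hz => ?_⟩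
  simp only [Equiv.apply_symm_apply]
  by_cases hzx : z ≤ x
  · exact Or.inl (hzx.trans le_sup_left)
  · refine Or.inr ((sup_le hxy hby).trans ?_)
    rcases hC.total hyC hz with h | h
    · exact h
    · exact hmin ⟨hz, hzx⟩ h

theorem eq_of_comparable_of_rank_eq {P : Type*} [PartialOrder P] [Finite P] {x y : P} (h : x ≤ y ∨ y ≤ x) (hr : rank x = rank y) :
    x = y := by
  by_contra hne
  rcases h with h | h
  · exact (rank_strictMono (lt_of_le_of_ne h hne)).ne hr
  · exact (rank_strictMono (lt_of_le_of_ne h (Ne.symm hne))).ne' hr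

variable [Finite P] [IsWeakUpperModularLattice P]

/-- Atoms are added one at a time so that every initial join stays comparable with `C`; comparable
elements of equal rank coincide, so the resulting maximal chain contains `C`. -/
theorem exists_isLabelWord_through_chain [IsAtomistic P] (a : Fin m ≃ {x : P // IsAtom x})
    (hu : rank u = n) {C : Set P} (hC : IsChain (· ≤ ·) C) (hCu : ∀ x ∈ C, x ≤ u) (huC : u ∈ C) :
    ∃ w : Fin n → Fin m, IsLabelWord a u w ∧ ∀ x ∈ C, initialJoin a w (rank x) = x := by
  have key : ∀ i ≤ n, ∃ v : Fin n → Fin m, rank (initialJoin a v i) = i ∧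
      ∀ i' ≤ i, ∀ x ∈ C, x ≤ initialJoin a v i' ∨ initialJoin a v i' ≤ x := by
    intro i
    induction i with
    | zero =>
      intro _
      -- An arbitrary starting word: only its first `i` letters matter at stage `i`.
      obtain ⟨v⟩ : Nonempty (Fin n → Fin m) := by
        rcases Nat.eq_zero_or_pos n with rfl | hn
        · exact ⟨Fin.elim0⟩
        · obtain ⟨j, -⟩ := exists_atom_comparable a hC (x := ⊥) (fun _ _ => Or.inr bot_le)
            ⟨u, huC, fun h => by rw [le_bot_iff.1 h, rank_bot] at hu; omega⟩
          exact ⟨fun _ => j⟩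
      refine ⟨v, by simp, fun i' hi' x _ => Or.inr ?_⟩
      rw [Nat.le_zero.1 hi', initialJoin_zero]
      exact bot_le
    | succ i ih =>
      intro hi
      obtain ⟨v, hr, hv⟩ := ih (by omega)
      obtain ⟨j, hj, hjC⟩ := exists_atom_comparable a hC (hv i le_rfl) ⟨u, huC, fun h => by
        have := rank_strictMono.monotone h
        omega⟩
      have hJ : ∀ i' ≤ i, initialJoin a (Function.update v ⟨i, hi⟩ j) i' = initialJoin a v i' :=
        fun i' hi' => initialJoin_congr fun l hl => Function.update_of_ne (by
          rintro rfl
          simp only at hl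
          omega) _ _
      have hs := initialJoin_succ (a := a) (w := Function.update v ⟨i, hi⟩ j) ⟨i, hi⟩
      simp only [Function.update_self, hJ i le_rfl] at hs
      refine ⟨Function.update v ⟨i, hi⟩ j, ?_, fun i' hi' => ?_⟩
      · rw [hs, rank_sup_isAtom (a j).2 hj, hr]
      · rcases Nat.le_succ_iff.1 hi' with h | rfl
        · rw [hJ i' h]
          exact hv i' h
        · rw [hs]
          exact hjC
  obtain ⟨v, hr, hv⟩ := key n le_rfl
  have hind := isIndependentWord_of_rank hr
  have hvu := eq_of_comparable_of_rank_eq (hv n le_rfl u huC) (hu.trans hr.symm)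
  obtain ⟨w, hw, hwv, -⟩ := hind.exists_isLabelWord (u := u) fun i => by
    rw [hvu]
    exact le_initialJoin i.2
  refine ⟨w, hw, fun x hx => ?_⟩
  have hxn : rank x ≤ n := hu ▸ rank_strictMono.monotone (hCu x hx)
  rw [hwv _ hxn]
  exact (eq_of_comparable_of_rank_eq (hv _ hxn x hx) (hind.rank_initialJoin hxn).symm).symm

theorem exists_isLeastWord [IsAtomistic P] (a : Fin m ≃ {x : P // IsAtom x}) (hu : rank u = n)
    {c : Fin k → P} (hc : StrictMono c) (hcu : ∀ i, c i ≤ u) :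
    ∃ w : Fin n → Fin m, IsLeastWord a u c w := by
  have hC : IsChain (· ≤ ·) (insert u (Set.range c)) := by
    refine IsChain.insert ?_ ?_
    · rintro _ ⟨i, rfl⟩ _ ⟨j, rfl⟩ -
      exact (le_total i j).imp (fun h => hc.monotone h) fun h => hc.monotone h
    · rintro _ ⟨i, rfl⟩ -
      exact Or.inr (hcu i)
  obtain ⟨w₀, hw₀, hw₀'⟩ := exists_isLabelWord_through_chain a hu hC
    (by rintro _ (rfl | ⟨i, rfl⟩); exacts [le_rfl, hcu i]) (Set.mem_insert _ _)
  obtain ⟨w, ⟨hw, hw'⟩, hmin⟩ := Set.exists_min_image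
    {w : Fin n → Fin m | IsLabelWord a u w ∧ PassesThrough a w c} toLex (Set.toFinite _)
    ⟨w₀, hw₀, fun i => hw₀' _ (Set.mem_insert_of_mem _ ⟨i, rfl⟩)⟩
  exact ⟨w, hw, hw', fun v h h' => hmin v ⟨h, h'⟩⟩

/-- Swapping the two letters at a descent `t` changes only the initial join of rank `t`. If `c` has
no element there, the label word of the new maximal chain still passes through `c` and is smaller
than `w`. -/
theorem IsLeastWord.exists_rank_eq {c : Fin k → P} (h : IsLeastWord a u c w) {t : ℕ}
    (ht : IsDescent w t) (hcn : ∀ i, rank (c i) ≤ n) : ∃ i, rank (c i) = t := by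
  by_contra! hne
  obtain ⟨i, j, hij, rfl, hlt⟩ := ht
  have hJ : ∀ l : ℕ, l ≠ j → initialJoin a (w ∘ Equiv.swap i j) l = initialJoin a w l := by
    refine fun l hl => initialJoin_comp_perm fun r => ?_
    rcases eq_or_ne r i with rfl | hri
    · rw [Equiv.swap_apply_left]
      omega
    rcases eq_or_ne r j with rfl | hrj
    · rw [Equiv.swap_apply_right]
      omega
    rw [Equiv.swap_apply_of_ne_of_ne hri hrj]
  obtain ⟨v, hv, hvJ, hvle⟩ :=
    (h.isLabelWord.independent.comp_perm (Equiv.swap i j)).exists_isLabelWord (u := u)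
      fun r => h.isLabelWord.le _
  have hle := h.toLex_le v hv fun l => by
    rw [hvJ _ (hcn l), hJ _ (hne l), h.passesThrough l]
  have hle' : toLex v ≤ toLex (w ∘ Equiv.swap i j) := Pi.toLex_monotone hvle
  refine absurd (hle.trans hle') (not_le.2 ⟨i, fun r hr => ?_, ?_⟩)
  · change w (Equiv.swap i j r) = w r
    rw [Equiv.swap_apply_of_ne_of_ne hr.ne]
    rintro rfl
    have : (r : ℕ) < i := hr
    omega
  · change w (Equiv.swap i j i) < w i
    rwa [Equiv.swap_apply_left]

end LeastWords

/-! ### Elimination -/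

section Elimination

/-- Elimination of leading terms, with a `key` that need not be injective. The functional in the
second alternative shows that `c` cannot have maximal key in the support of an element of `Z`; every
term of maximal key can therefore be cancelled by an element of `B`. -/
theorem le_of_elimination {𝕜 X K : Type*} [Field 𝕜] [LinearOrder K] [WellFoundedLT K]
    (adm : Set X) (key : X → K) (Z B : Submodule 𝕜 (X →₀ 𝕜)) (hBZ : B ≤ Z)
    (hZ : Z ≤ Finsupp.supported 𝕜 𝕜 adm)
    (h : ∀ c ∈ adm, (∃ b ∈ B, b c ≠ 0 ∧ ∀ e, e ≠ c → b e ≠ 0 → key e < key c) ∨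
      ∃ φ : (X →₀ 𝕜) →ₗ[𝕜] 𝕜, (∀ z ∈ Z, φ z = 0) ∧ φ (Finsupp.single c 1) ≠ 0 ∧
        ∀ e ∈ adm, e ≠ c → key e ≤ key c → φ (Finsupp.single e 1) = 0) : Z ≤ B := by
  suffices H : ∀ κ : K, ∀ z ∈ Z, (∀ e, z e ≠ 0 → key e ≤ κ) → z ∈ B by
    intro z hz
    rcases z.support.eq_empty_or_nonempty with h0 | hne
    · rw [Finsupp.support_eq_empty.1 h0]
      exact B.zero_mem
    · obtain ⟨c, -, hmax⟩ := z.support.exists_max_image key hne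
      exact H (key c) z hz fun e he => hmax e (Finsupp.mem_support_iff.2 he)
  intro κ
  induction κ using WellFoundedLT.induction with
  | ind κ ih =>
  intro z hz hzκ
  have hadm : ∀ {y}, y ∈ Z → ∀ e, y e ≠ 0 → e ∈ adm := fun hy e he =>
    (Finsupp.mem_supported _ _).1 (hZ hy) (Finsupp.mem_support_iff.2 he)
  have hlead : ∀ c, z c ≠ 0 → key c = κ →
      ∃ b ∈ B, b c ≠ 0 ∧ ∀ e, e ≠ c → b e ≠ 0 → key e < key c := by
    intro c hc hκ
    refine (h c (hadm hz c hc)).resolve_right ?_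
    rintro ⟨φ, hφ, hφc, hφe⟩
    have h₁ := hφ z hz
    rw [← Finsupp.sum_single z, Finsupp.sum, map_sum, Finset.sum_eq_single c] at h₁
    · rw [← mul_one (z c), ← smul_eq_mul, ← Finsupp.smul_single, map_smul, smul_eq_mul] at h₁
      exact (mul_ne_zero hc hφc) h₁
    · intro e he hne
      have he := Finsupp.mem_support_iff.1 he
      rw [← mul_one (z e), ← smul_eq_mul, ← Finsupp.smul_single, map_smul,
        hφe e (hadm hz e he) hne (hκ ▸ hzκ e he), smul_zero]
    · intro h'
      exact absurd (Finsupp.mem_support_iff.2 hc) h'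
  have hb : ∀ c, ∃ b ∈ B, (key c = κ → b c = z c) ∧ ∀ e, e ≠ c → b e ≠ 0 → key e < key c := by
    intro c
    by_cases hc : z c ≠ 0 ∧ key c = κ
    · obtain ⟨b, hbB, hbc, hbe⟩ := hlead c hc.1 hc.2
      refine ⟨(z c / b c) • b, B.smul_mem _ hbB, fun _ => ?_, fun e he hbe' => hbe e he ?_⟩
      · rw [Finsupp.smul_apply, smul_eq_mul, div_mul_cancel₀ _ hbc]
      · rintro h0
        exact hbe' (by rw [Finsupp.smul_apply, h0, smul_zero])
    · refine ⟨0, B.zero_mem, fun h₁ => ?_, fun e _ he => absurd rfl he⟩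
      by_contra h₂
      exact hc ⟨fun h₃ => h₂ h₃.symm, h₁⟩
  choose b hbB hb using hb
  classical
  -- All terms of key `κ` are cancelled at once. They do not interfere, since the other terms of
  -- each `b c` have smaller keys.
  set y := ∑ c ∈ z.support with key c = κ, b c with hy
  have hyB : y ∈ B := B.sum_mem fun c _ => hbB c
  suffices hzy : z - y ∈ B by simpa using B.add_mem hzy hyB
  have hyκ : ∀ e, y e ≠ 0 → key e ≤ κ := by
    intro e he
    rw [hy, Finsupp.finsetSum_apply] at he
    obtain ⟨c, hc, hce⟩ := Finset.exists_ne_zero_of_sum_ne_zero he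
    simp only [Finset.mem_filter, Finsupp.mem_support_iff] at hc
    rcases eq_or_ne e c with rfl | hne
    · exact hc.2.le
    · exact (((hb c).2 e hne hce).trans_eq hc.2).le
  have hyeq : ∀ e, key e = κ → y e = z e := by
    intro e he
    rw [hy, Finsupp.finsetSum_apply, Finset.sum_eq_single e]
    · exact (hb e).1 he
    · intro c hc hne
      simp only [Finset.mem_filter, Finsupp.mem_support_iff] at hc
      by_contra hce
      exact absurd ((hb c).2 e (Ne.symm hne) hce) (by rw [he, hc.2]; exact lt_irrefl _)
    · intro h'
      rw [(hb e).1 he]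
      by_contra h0
      exact h' (Finset.mem_filter.2 ⟨Finsupp.mem_support_iff.2 h0, he⟩)
  have hlt : ∀ e, (z - y) e ≠ 0 → key e < κ := by
    intro e he
    refine lt_of_le_of_ne ?_ fun h' => he (by rw [Finsupp.sub_apply, hyeq e h', sub_self])
    by_contra hgt
    have h₁ : z e = 0 := by
      by_contra h0
      exact hgt (hzκ e h0)
    have h₂ : y e = 0 := by
      by_contra h0
      exact hgt (hyκ e h0)
    exact he (by rw [Finsupp.sub_apply, h₁, h₂, sub_self])
  rcases (z - y).support.eq_empty_or_nonempty with h0 | hne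
  · rw [Finsupp.support_eq_empty.1 h0]
    exact B.zero_mem
  · obtain ⟨c, hc, hmax⟩ := (z - y).support.exists_max_image key hne
    exact ih (key c) (hlt c (Finsupp.mem_support_iff.1 hc)) (z - y) (Z.sub_mem hz (hBZ hyB))
      fun e he => hmax e (Finsupp.mem_support_iff.2 he)

theorem linearIndependent_of_leading {𝕜 X ι : Type*} [Field 𝕜] [LinearOrder ι]
    (ρ : ι → X →₀ 𝕜) (lead : ι → X) (h₁ : ∀ i, ρ i (lead i) ≠ 0)
    (h₂ : ∀ i j, ρ i (lead j) ≠ 0 → j ≤ i) : LinearIndependent 𝕜 ρ := by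
  classical
  rw [linearIndependent_iff']
  intro s g hg
  by_contra! hne
  obtain ⟨i₀, hi₀, hgi₀⟩ := hne
  obtain ⟨i, hi, hmax⟩ := (s.filter fun i => g i ≠ 0).exists_max_image id
    ⟨i₀, Finset.mem_filter.2 ⟨hi₀, hgi₀⟩⟩
  rw [Finset.mem_filter] at hi
  have := DFunLike.congr_fun hg (lead i)
  rw [Finsupp.finsetSum_apply, Finset.sum_eq_single i] at this
  · exact mul_ne_zero hi.2 (h₁ i) this
  · intro j hj hji
    by_contra hne
    rw [Finsupp.smul_apply, smul_eq_mul] at hne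
    exact hji (le_antisymm (hmax j (Finset.mem_filter.2 ⟨hj, left_ne_zero_of_mul hne⟩))
      (h₂ j i (right_ne_zero_of_mul hne)))
  · exact fun h' => absurd hi.1 h'

end Elimination

/-! ### Ribbons -/

section Ribbons

theorem card_filter_Icc_eq_iff (p : ℕ → Prop) [DecidablePred p] {i j : ℕ} (h : i ≤ j) :
    ((Finset.Icc 1 i).filter p).card = ((Finset.Icc 1 j).filter p).card ↔
      ∀ t, i < t → t ≤ j → ¬ p t := by
  have hsub : (Finset.Icc 1 i).filter p ⊆ (Finset.Icc 1 j).filter p :=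
    Finset.filter_subset_filter _ (Finset.Icc_subset_Icc_right h)
  constructor
  · intro hcard t hit htj hpt
    have := Finset.eq_of_subset_of_card_le hsub hcard.ge
    have ht : t ∈ (Finset.Icc 1 j).filter p := by
      simp only [Finset.mem_filter, Finset.mem_Icc]
      exact ⟨⟨by omega, htj⟩, hpt⟩
    rw [← this] at ht
    simp only [Finset.mem_filter, Finset.mem_Icc] at ht
    omega
  · intro hp
    congr 1
    refine hsub.antisymm fun t ht => ?_
    simp only [Finset.mem_filter, Finset.mem_Icc] at ht ⊢
    refine ⟨⟨ht.1.1, ?_⟩, ht.2⟩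
    by_contra hlt
    exact hp t (by omega) ht.1.2 ht.2

theorem ribbonRow_eq_iff {T : Finset ℕ} {i j : ℕ} (h : i ≤ j) :
    ribbonRow T i = ribbonRow T j ↔ ∀ t, i < t → t ≤ j → t ∉ T :=
  card_filter_Icc_eq_iff _ h

theorem ribbonCol_eq_iff {T : Finset ℕ} {i j : ℕ} (h : i ≤ j) :
    ribbonCol T i = ribbonCol T j ↔ ∀ t, i < t → t ≤ j → t ∈ T := by
  exact (card_filter_Icc_eq_iff (· ∉ T) h).trans (by simp)

/-- Translates the row description of tabloids into initial segments of the reading word. -/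
theorem ribbonRow_le_iff {T : Finset ℕ} (hT : 0 ∉ T) (j : ℕ) (l : Fin T.card) :
    ribbonRow T j ≤ l ↔ j < T.orderEmbOfFin rfl l := by
  constructor
  · intro h
    by_contra! hle
    have hsub : (Finset.Iic l).map (T.orderEmbOfFin rfl).toEmbedding ⊆
        (Finset.Icc 1 j).filter (· ∈ T) := by
      intro t ht
      simp only [Finset.mem_map, Finset.mem_Iic, RelEmbedding.coe_toEmbedding] at ht
      obtain ⟨i, hi, rfl⟩ := ht
      have hmem := T.orderEmbOfFin_mem rfl i
      simp only [Finset.mem_filter, Finset.mem_Icc]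
      refine ⟨⟨Nat.pos_of_ne_zero fun h0 => hT (h0 ▸ hmem), ?_⟩, hmem⟩
      exact ((T.orderEmbOfFin rfl).monotone hi).trans hle
    have := Finset.card_le_card hsub
    rw [Finset.card_map, Fin.card_Iic] at this
    simp only [ribbonRow] at h
    omega
  · intro h
    have hsub : (Finset.Icc 1 j).filter (· ∈ T) ⊆
        (Finset.Iio l).map (T.orderEmbOfFin rfl).toEmbedding := by
      intro t ht
      simp only [Finset.mem_filter, Finset.mem_Icc] at ht
      obtain ⟨i, rfl⟩ : t ∈ Set.range (T.orderEmbOfFin rfl) := by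
        rw [Finset.range_orderEmbOfFin]
        exact ht.2
      simp only [Finset.mem_map, Finset.mem_Iio, RelEmbedding.coe_toEmbedding]
      exact ⟨i, (T.orderEmbOfFin rfl).lt_iff_lt.1 (ht.1.2.trans_lt h), rfl⟩
    have := Finset.card_le_card hsub
    rwa [Finset.card_map, Fin.card_Iio] at this

theorem isStandardFilling_iff {T : Finset ℕ} {n m : ℕ} {w : Fin n → Fin m}
    (hw : Function.Injective w) : IsStandardFilling T w ↔
      ∀ i j : Fin n, (i : ℕ) + 1 = j → ((j : ℕ) ∈ T ↔ w j < w i) := by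
  constructor
  · intro h i j hij
    have hlt : i < j := Fin.lt_def.2 (by omega)
    refine ⟨fun hj => h.col_lt i j hlt ?_, fun hj => ?_⟩
    · rw [ribbonCol_eq_iff hlt.le]
      intro t h₁ h₂
      rwa [show t = j by omega]
    · by_contra hjT
      refine absurd (h.row_lt i j hlt ?_) hj.not_gt
      rw [ribbonRow_eq_iff hlt.le]
      intro t h₁ h₂
      rwa [show t = j by omega]
  · intro h
    have key : ∀ i : Fin n, ∀ j, ∀ hj : j < n, (i : ℕ) < j →
        ((∀ t, (i : ℕ) < t → t ≤ j → t ∉ T) → w i < w ⟨j, hj⟩) ∧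
        ((∀ t, (i : ℕ) < t → t ≤ j → t ∈ T) → w ⟨j, hj⟩ < w i) := by
      intro i j hj hij
      induction j, hij using Nat.le_induction with
      | base =>
        have hij := h i ⟨(i : ℕ) + 1, hj⟩ rfl
        refine ⟨fun hT => ?_, fun hT => hij.1 (hT _ (by simp) le_rfl)⟩
        refine lt_of_le_of_ne (not_lt.1 fun h' => hT _ (by simp) le_rfl (hij.2 h')) fun h' => ?_
        have := congrArg Fin.val (hw h')
        simp at this
      | succ j hij ih =>
        have hjj := h ⟨j, by omega⟩ ⟨j + 1, hj⟩ rfl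
        obtain ⟨ih₁, ih₂⟩ := ih (by omega)
        refine ⟨fun hT => (ih₁ fun t h₁ h₂ => hT t h₁ (by omega)).trans ?_,
          fun hT => lt_trans (hjj.1 (hT (j + 1) (by omega) le_rfl))
            (ih₂ fun t h₁ h₂ => hT t h₁ (by omega))⟩
        refine lt_of_le_of_ne (not_lt.1 fun h' => hT (j + 1) (by omega) le_rfl (hjj.2 h')) fun h' => ?_
        have := congrArg Fin.val (hw h')
        simp at this
    exact ⟨fun i j hij hr => (key i j j.2 hij).1 ((ribbonRow_eq_iff (le_of_lt hij)).1 hr),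
      fun i j hij hc => (key i j j.2 hij).2 ((ribbonCol_eq_iff (le_of_lt hij)).1 hc)⟩

/-- The permutations of the boxes of a ribbon that preserve the columns. -/
def columnPerms (T : Finset ℕ) (n : ℕ) : Finset (Equiv.Perm (Fin n)) :=
  {σ | ∀ i : Fin n, ribbonCol T (σ i) = ribbonCol T i}

theorem one_mem_columnPerms (T : Finset ℕ) (n : ℕ) : 1 ∈ columnPerms T n := by
  simp [columnPerms]

/-- The first moved box receives the entry of a later box in its column, which is higher up and so
has a smaller entry. -/
theorem IsStandardFilling.toLex_comp_lt {T : Finset ℕ} {n m : ℕ} {w : Fin n → Fin m}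
    (h : IsStandardFilling T w) {σ : Equiv.Perm (Fin n)} (hσ : σ ∈ columnPerms T n)
    (hne : σ ≠ 1) : toLex (w ∘ σ) < toLex w := by
  obtain ⟨i₀, hi₀⟩ : ∃ i, σ i ≠ i := by
    by_contra! h'
    exact hne (Equiv.ext h')
  obtain ⟨p, hp, hmin⟩ := (Finset.univ.filter fun i => σ i ≠ i).exists_min_image id
    ⟨i₀, by simpa using hi₀⟩
  have hfix : ∀ j < p, σ j = j := by
    intro j hj
    by_contra hne
    exact absurd (hmin j (by simpa using hne)) (not_le.2 hj)
  have hp : σ p ≠ p := by simpa using hp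
  refine ⟨p, fun j hj => congrArg w (hfix j hj), ?_⟩
  refine h.col_lt p (σ p) ?_ ((Finset.mem_filter.1 hσ).2 p).symm
  refine lt_of_le_of_ne (not_lt.1 fun hlt => ?_) hp.symm
  exact hp (σ.injective (hfix _ hlt))

/-! ### Ribbon elements: cycle property and leading chains -/

variable {P : Type*} [Lattice P] [BoundedOrder P] {m n k : ℕ} {a : Fin m ≃ {x : P // IsAtom x}}

theorem chainOfTabloid_tabloid {T : Finset ℕ} (hT : 0 ∉ T) (v : Fin n → Fin m) :
    chainOfTabloid a T.card (tabloid T v) =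
      fun l => initialJoin a v (T.orderEmbOfFin rfl l) := by
  funext l
  refine eq_of_forall_ge_iff fun y => ?_
  simp only [chainOfTabloid, tabloid, Finset.sup_le_iff, join_le_iff, initialJoin_le_iff,
    Finset.mem_range, Finset.mem_image, Finset.mem_filter, Finset.mem_univ, true_and,
    ← ribbonRow_le_iff hT]
  constructor
  · exact fun h j hj => h _ (Nat.lt_succ_iff.2 hj) _ ⟨j, rfl, rfl⟩
  · rintro h r hr _ ⟨j, rfl, rfl⟩
    exact h j (Nat.lt_succ_iff.1 hr)

theorem ribbonElement_eq (𝕜 : Type*) [Field 𝕜] {T : Finset ℕ} (hT : 0 ∉ T) (w : Fin n → Fin m) :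
    ribbonElement 𝕜 a T w = ∑ σ ∈ columnPerms T n,
      Finsupp.single (fun l => initialJoin a (w ∘ σ) (T.orderEmbOfFin rfl l))
        ((Equiv.Perm.sign σ : ℤ) : 𝕜) := by
  rw [ribbonElement, polytabloid, map_sum]
  refine Finset.sum_congr rfl fun σ _ => ?_
  rw [Finsupp.lmapDomain_apply, Finsupp.mapDomain_single, chainOfTabloid_tabloid hT]

theorem boundary_single (𝕜 : Type*) [Field 𝕜] (P : Type*) (c : Fin (k + 1) → P) (s : 𝕜) :
    boundary 𝕜 P k (Finsupp.single c s) =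
      ∑ i : Fin (k + 1), Finsupp.single (i.removeNth c) (s * (-1 : 𝕜) ^ (i : ℕ)) := by
  rw [boundary, Finsupp.linearCombination_single, Finset.smul_sum]
  simp

variable {u : P} {w : Fin n → Fin m}

/-- Deleting the entry of rank `τ i` hides the effect of swapping the two adjacent column boxes on
either side of that cut, while the swap reverses the sign; so the faces cancel in pairs. -/
theorem boundary_sum_columnPerms (𝕜 : Type*) [Field 𝕜] {T : Finset ℕ} {τ : Fin (k + 1) → ℕ}
    (hτ : Function.Injective τ) (hτT : ∀ i, τ i ∈ T) (hT : ∀ t ∈ T, 0 < t ∧ t < n) :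
    boundary 𝕜 P k (∑ σ ∈ columnPerms T n,
      Finsupp.single (fun l => initialJoin a (w ∘ σ) (τ l)) ((Equiv.Perm.sign σ : ℤ) : 𝕜)) = 0 := by
  simp only [map_sum, boundary_single]
  rw [Finset.sum_comm]
  refine Finset.sum_eq_zero fun i _ => ?_
  obtain ⟨h₀, h₁⟩ := hT _ (hτT i)
  -- With boxes numbered from `0`, the last box below the cut is `τ i - 1` and the first one above
  -- it is `τ i`.
  set p : Fin n := ⟨τ i - 1, by omega⟩ with hp
  set q : Fin n := ⟨τ i, h₁⟩ with hq
  have hpq : p ≠ q := fun h => by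
    have := congrArg Fin.val h
    simp only [hp, hq] at this
    omega
  have hcol : ribbonCol T p = ribbonCol T q := by
    rw [ribbonCol_eq_iff (by simp [hp, hq])]
    intro t h₁ h₂
    simp only [hp, hq] at h₁ h₂
    rw [show t = τ i by omega]
    exact hτT i
  have hswap : ∀ j : Fin n, ribbonCol T (Equiv.swap p q j) = ribbonCol T j := by
    intro j
    rcases eq_or_ne j p with rfl | hjp
    · rw [Equiv.swap_apply_left, hcol]
    rcases eq_or_ne j q with rfl | hjq
    · rw [Equiv.swap_apply_right, hcol]
    rw [Equiv.swap_apply_of_ne_of_ne hjp hjq]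
  refine Finset.sum_involution (fun σ _ => σ * Equiv.swap p q) ?_ ?_ ?_ ?_
  · intro σ _
    have hrem : i.removeNth (fun l => initialJoin a (w ∘ ⇑(σ * Equiv.swap p q)) (τ l)) =
        i.removeNth fun l => initialJoin a (w ∘ σ) (τ l) := by
      funext l
      simp only [Fin.removeNth_apply, Equiv.Perm.coe_mul, ← Function.comp_assoc]
      refine initialJoin_comp_perm fun j => ?_
      have hne : τ (i.succAbove l) ≠ τ i := fun h => Fin.succAbove_ne i l (hτ h)
      rcases eq_or_ne j p with rfl | hjp
      · rw [Equiv.swap_apply_left]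
        simp only [hp, hq]
        omega
      rcases eq_or_ne j q with rfl | hjq
      · rw [Equiv.swap_apply_right]
        simp only [hp, hq]
        omega
      rw [Equiv.swap_apply_of_ne_of_ne hjp hjq]
    rw [hrem, Equiv.Perm.sign_mul, Equiv.Perm.sign_swap hpq, ← Finsupp.single_add]
    simp
  · intro σ _ _ h
    rw [mul_eq_left, Equiv.swap_eq_one_iff] at h
    exact hpq h
  · intro σ hσ
    simp only [columnPerms, Finset.mem_filter, Finset.mem_univ, true_and] at hσ ⊢
    intro j
    rw [Equiv.Perm.mul_apply, hσ, hswap]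
  · intro σ _
    rw [mul_assoc, Equiv.swap_mul_self, mul_one]

theorem exists_of_ribbonElement_ne_zero {𝕜 : Type*} [Field 𝕜] {T : Finset ℕ} (hT : 0 ∉ T)
    {e : Fin T.card → P} (h : ribbonElement 𝕜 a T w e ≠ 0) :
    ∃ σ ∈ columnPerms T n, e = fun l => initialJoin a (w ∘ σ) (T.orderEmbOfFin rfl l) := by
  rw [ribbonElement_eq 𝕜 hT, Finsupp.finsetSum_apply] at h
  obtain ⟨σ, hσ, hne⟩ := Finset.exists_ne_zero_of_sum_ne_zero h
  refine ⟨σ, hσ, ?_⟩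
  by_contra h'
  exact hne (Finsupp.single_eq_of_ne h')

theorem IsStandardFilling.mem_of_isDescent {T : Finset ℕ} (hw : IsLabelWord a u w)
    (hs : IsStandardFilling T w) {t : ℕ} (ht : IsDescent w t) : t ∈ T := by
  obtain ⟨i, j, hij, rfl, hlt⟩ := ht
  exact ((isStandardFilling_iff hw.independent.injective).1 hs i j hij).2 hlt

variable [Finite P] [IsWeakUpperModularLattice P]

/-- The entries of `w`, joined up to the positions `τ`, give a chain in the rank-selected open
interval. -/
theorem IsIndependentWord.chain_mem {T : Finset ℕ} {A : Set P}
    (hA : ∀ x, x ∈ A ↔ x < u ∧ rank x ∈ T) (hT : ∀ t ∈ T, 0 < t ∧ t < n)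
    (hw : IsIndependentWord a w) (hwu : initialJoin a w n = u) {τ : Fin k → ℕ}
    (hτ : StrictMono τ) (hτT : ∀ i, τ i ∈ T) :
    (fun l => initialJoin a w (τ l)) ∈ {c : Fin k → P | StrictMono c ∧ ∀ i, c i ∈ A} := by
  have hlt : ∀ {i j : ℕ}, i < j → j ≤ n → initialJoin a w i < initialJoin a w j := by
    intro i j hij hj
    refine lt_of_le_of_ne (initialJoin_mono hij.le) fun h => ?_
    have := congrArg rank h
    rw [hw.rank_initialJoin hj, hw.rank_initialJoin (by omega)] at this
    omega
  refine ⟨fun i j hij => hlt (hτ hij) (hT _ (hτT j)).2.le, fun i => ?_⟩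
  have := (hT _ (hτT i)).2
  rw [hA, hw.rank_initialJoin this.le]
  exact ⟨hwu ▸ hlt this le_rfl, hτT i⟩

theorem ribbonElement_mem_cycles (𝕜 : Type*) [Field 𝕜] {T : Finset ℕ} {A : Set P}
    (hA : ∀ x, x ∈ A ↔ x < u ∧ rank x ∈ T) (hT : ∀ t ∈ T, 0 < t ∧ t < n)
    (hw : IsIndependentWord a w) (hwu : initialJoin a w n = u) :
    ribbonElement 𝕜 a T w ∈ cycles 𝕜 A T.card := by
  rw [ribbonElement_eq 𝕜 fun h0 => absurd (hT 0 h0).1 (lt_irrefl _)]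
  have hτ : StrictMono (T.orderEmbOfFin rfl) := (T.orderEmbOfFin rfl).strictMono
  have hτT : ∀ i, T.orderEmbOfFin rfl i ∈ T := T.orderEmbOfFin_mem rfl
  generalize ⇑(T.orderEmbOfFin rfl) = τ at hτ hτT
  have hmem : (∑ σ ∈ columnPerms T n, Finsupp.single (fun l => initialJoin a (w ∘ σ) (τ l))
      ((Equiv.Perm.sign σ : ℤ) : 𝕜)) ∈ chains 𝕜 A T.card :=
    Submodule.sum_mem _ fun σ _ => Finsupp.single_mem_supported _ _
      ((hw.comp_perm σ).chain_mem hA hT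
        ((initialJoin_comp_perm fun j => by simp).trans hwu) hτ hτT)
  generalize T.card = k at τ hτ hτT hmem
  cases k with
  | zero => exact hmem
  | succ k => exact ⟨hmem, boundary_sum_columnPerms 𝕜 hτ.injective hτT hT⟩

/-- Through every chain that occurs in the ribbon element of `w` there is a maximal chain whose
label word is at most `w`, and less than `w` unless the column permutation is trivial. -/
theorem IsLabelWord.exists_passesThrough {T : Finset ℕ} (hT : ∀ t ∈ T, 0 < t ∧ t < n)
    (hw : IsLabelWord a u w) (hs : IsStandardFilling T w) {σ : Equiv.Perm (Fin n)}
    (hσ : σ ∈ columnPerms T n) :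
    ∃ v, IsLabelWord a u v ∧
      PassesThrough a v (fun l => initialJoin a (w ∘ σ) (T.orderEmbOfFin rfl l)) ∧
      toLex v ≤ toLex w ∧ (σ ≠ 1 → toLex v < toLex w) := by
  have hind := hw.independent.comp_perm σ
  obtain ⟨v, hv, hvJ, hvle⟩ := hind.exists_isLabelWord (u := u) fun r => hw.le _
  have hle : toLex v ≤ toLex (w ∘ σ) := Pi.toLex_monotone hvle
  refine ⟨v, hv, fun l => ?_, ?_, fun h => hle.trans_lt (hs.toLex_comp_lt hσ h)⟩
  · have := (hT _ (T.orderEmbOfFin_mem rfl l)).2.le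
    rw [hind.rank_initialJoin this, hvJ _ this]
  · rcases eq_or_ne σ 1 with rfl | h
    · exact hle
    · exact (hle.trans_lt (hs.toLex_comp_lt hσ h)).le

theorem IsLabelWord.isLeastWord (hw : IsLabelWord a u w) (hu : rank u = n) {c : Fin k → P}
    (hc : PassesThrough a w c) (hd : ∀ t, IsDescent w t → ∃ i, rank (c i) = t) :
    IsLeastWord a u c w := by
  refine ⟨hw, hc, fun v hv hvc => ?_⟩
  refine hw.toLex_le hv (hw.independent.initialJoin_eq hu hw.le)
    (U := Set.range fun i => rank (c i)) hd ?_
  rintro _ ⟨i, rfl⟩ -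
  exact (hvc i).trans (hc i).symm

theorem IsStandardFilling.isLeastWord {T : Finset ℕ} (hT : ∀ t ∈ T, 0 < t ∧ t < n)
    (hu : rank u = n) (hw : IsLabelWord a u w) (hs : IsStandardFilling T w) :
    IsLeastWord a u (fun l => initialJoin a w (T.orderEmbOfFin rfl l)) w := by
  have hr : ∀ l, rank (initialJoin a w (T.orderEmbOfFin rfl l)) = T.orderEmbOfFin rfl l :=
    fun l => hw.independent.rank_initialJoin (hT _ (T.orderEmbOfFin_mem rfl l)).2.le
  refine hw.isLeastWord hu (fun l => by rw [hr]) fun t ht => ?_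
  obtain ⟨l, rfl⟩ : t ∈ Set.range (T.orderEmbOfFin rfl) := by
    rw [Finset.range_orderEmbOfFin]
    exact hs.mem_of_isDescent hw ht
  exact ⟨l, hr l⟩

/-- Only the identity contributes: any other column permutation giving the same chain would yield a
label word through it smaller than the least one, `w`. -/
theorem ribbonElement_leading {𝕜 : Type*} [Field 𝕜] {T : Finset ℕ}
    (hT : ∀ t ∈ T, 0 < t ∧ t < n) (hu : rank u = n) (hw : IsLabelWord a u w)
    (hs : IsStandardFilling T w) :
    ribbonElement 𝕜 a T w (fun l => initialJoin a w (T.orderEmbOfFin rfl l)) = 1 := by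
  rw [ribbonElement_eq 𝕜 fun h0 => absurd (hT 0 h0).1 (lt_irrefl _), Finsupp.finsetSum_apply,
    Finset.sum_eq_single 1]
  · simp
  · intro σ hσ hne
    refine Finsupp.single_eq_of_ne fun h => ?_
    obtain ⟨v, hv, hvc, -, hlt⟩ := hw.exists_passesThrough hT hs hσ
    exact absurd (hlt hne) (not_lt.2 ((hs.isLeastWord hT hu hw).toLex_le v hv (h ▸ hvc)))
  · exact fun h => absurd (one_mem_columnPerms T n) h

end Ribbons

/-! ### The complex of chains -/

section Complex

theorem eq_of_strictMono_of_forall_exists {P : Type*} [PartialOrder P] {k : ℕ} {c d : Fin k → P}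
    (hc : StrictMono c) (hd : StrictMono d) (h : ∀ i, ∃ j, c i = d j) : c = d := by
  refine (StrictMono.range_inj hc hd).1 (Set.eq_of_subset_of_ncard_le ?_ ?_ (Set.toFinite _))
  · rintro _ ⟨i, rfl⟩
    obtain ⟨j, hj⟩ := h i
    exact ⟨j, hj.symm⟩
  · rw [Set.ncard_range_of_injective hc.injective, Set.ncard_range_of_injective hd.injective]

theorem removeNth_left_injective {X : Type*} {k : ℕ} {c : Fin (k + 1) → X}
    (hc : Function.Injective c) {i j : Fin (k + 1)} (h : i.removeNth c = j.removeNth c) :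
    i = j := by
  by_contra hne
  obtain ⟨l, hl⟩ := Fin.exists_succAbove_eq (Ne.symm hne)
  have := congrFun h l
  simp only [Fin.removeNth_apply, hl] at this
  exact Fin.succAbove_ne j l (hc this).symm

variable (𝕜 : Type*) [Field 𝕜] {P : Type*} {k : ℕ}

theorem boundary_single_ne_zero {c : Fin (k + 1) → P} {s : 𝕜} {d : Fin k → P}
    (h : boundary 𝕜 P k (Finsupp.single c s) d ≠ 0) : ∃ i : Fin (k + 1), d = i.removeNth c := by
  rw [boundary_single, Finsupp.finsetSum_apply] at h
  obtain ⟨i, -, hi⟩ := Finset.exists_ne_zero_of_sum_ne_zero h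
  refine ⟨i, ?_⟩
  by_contra h'
  exact hi (Finsupp.single_eq_of_ne h')

theorem boundary_single_removeNth {c : Fin (k + 1) → P} (hc : Function.Injective c)
    (i : Fin (k + 1)) :
    boundary 𝕜 P k (Finsupp.single c 1) (i.removeNth c) = (-1 : 𝕜) ^ (i : ℕ) := by
  rw [boundary_single, Finsupp.finsetSum_apply, Finset.sum_eq_single i]
  · simp
  · intro j _ hj
    exact Finsupp.single_eq_of_ne fun h => hj (removeNth_left_injective hc h).symm
  · exact fun h => absurd (Finset.mem_univ _) h

theorem boundary_boundary (z : Tuples 𝕜 P (k + 2)) :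
    boundary 𝕜 P k (boundary 𝕜 P (k + 1) z) = 0 := by
  induction z using Finsupp.induction_linear with
  | zero => simp
  | add f g hf hg => rw [map_add, map_add, hf, hg, add_zero]
  | single c s =>
    simp only [boundary_single, map_sum, ← Finset.sum_product']
    refine Finset.sum_involution (fun p _ => (p.1.succAbove p.2, p.2.predAbove p.1)) ?_ ?_ ?_ ?_
    · rintro ⟨i, j⟩ -
      simp only
      rw [Fin.removeNth_removeNth_eq_swap c j i, ← Finsupp.single_add, mul_assoc, mul_assoc,
        ← pow_add, ← pow_add, Fin.neg_one_pow_succAbove_add_predAbove]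
      simp
    · rintro ⟨i, j⟩ - - h
      exact Fin.succAbove_ne i j (congrArg Prod.fst h)
    · simp
    · rintro ⟨i, j⟩ -
      simp only [Fin.succAbove_succAbove_predAbove, Fin.predAbove_predAbove_succAbove]

variable [PartialOrder P] (A : Set P)

theorem boundaries_le_cycles (k : ℕ) : boundaries 𝕜 A k ≤ cycles 𝕜 A k := by
  have h : boundaries 𝕜 A k ≤ chains 𝕜 A k := by
    rw [boundaries, chains, Finsupp.supported_eq_span_single, Submodule.map_span_le]
    rintro _ ⟨c, ⟨hc, hcA⟩, rfl⟩
    rw [boundary_single]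
    exact Submodule.sum_mem _ fun i _ => Finsupp.single_mem_supported _ _
      ⟨hc.comp (Fin.strictMono_succAbove i), fun j => hcA _⟩
  cases k with
  | zero => exact h
  | succ k =>
    refine le_inf h ?_
    rintro _ ⟨z, -, rfl⟩
    exact boundary_boundary 𝕜 z

theorem cycles_le_chains (k : ℕ) : cycles 𝕜 A k ≤ chains 𝕜 A k := by
  cases k with
  | zero => exact le_rfl
  | succ k => exact inf_le_left

end Complex

/-! ### Homology of rank-selected intervals -/

section Homology

variable {P : Type*} [Lattice P] [BoundedOrder P]
  {m n k : ℕ} {a : Fin m ≃ {x : P // IsAtom x}} {u : P} {w : Fin n → Fin m} {T : Finset ℕ}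
  {A : Set P}

theorem exists_not_isDescent (hw : IsLabelWord a u w) (hd : ∀ t, IsDescent w t → t ∈ T)
    (hs : ¬ IsStandardFilling T w) : ∃ t ∈ T, ¬ IsDescent w t := by
  by_contra! h
  refine hs ((isStandardFilling_iff hw.independent.injective).2 fun i j hij =>
    ⟨fun hj => ?_, fun hlt => hd _ ⟨i, j, hij, rfl, hlt⟩⟩)
  obtain ⟨i', j', hij', hj', hlt⟩ := h _ hj
  obtain rfl : j' = j := Fin.ext hj'
  obtain rfl : i' = i := Fin.ext (by omega)
  exact hlt

variable [Finite P] [IsWeakUpperModularLattice P]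

/-- Insert into `c` the element of rank `t` of the maximal chain of `w` and take the boundary. One
face is `c`; all others still contain the new element and lie on that maximal chain. -/
theorem exists_boundary_leading (𝕜 : Type*) [Field 𝕜] (hA : ∀ x, x ∈ A ↔ x < u ∧ rank x ∈ T)
    (hT : ∀ t ∈ T, 0 < t ∧ t < n) (hu : rank u = n) (hw : IsLabelWord a u w) {c : Fin k → P}
    (hc : StrictMono c) (hcA : ∀ i, c i ∈ A) (hwc : PassesThrough a w c) {t : ℕ} (ht : t ∈ T)
    (htc : ∀ i, rank (c i) ≠ t) :
    ∃ b ∈ boundaries 𝕜 A k, b c ≠ 0 ∧ ∀ e, e ≠ c → b e ≠ 0 →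
      (StrictMono e ∧ ∀ i, e i ∈ A) ∧ PassesThrough a w e ∧ ∃ i, rank (e i) = t := by
  set U : Finset ℕ := insert t (Finset.univ.image fun i => rank (c i)) with hU
  have hcard : U.card = k + 1 := by
    have hinj : Function.Injective fun i => rank (c i) := (rank_strictMono.comp hc).injective
    rw [hU, Finset.card_insert_of_notMem (by simpa using htc),
      Finset.card_image_of_injective _ hinj, Finset.card_univ,
      Fintype.card_fin]
  have hUT : ∀ s ∈ U, s ∈ T := by
    intro s hs
    rw [hU, Finset.mem_insert, Finset.mem_image] at hs
    rcases hs with rfl | ⟨i, -, rfl⟩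
    · exact ht
    · exact ((hA _).1 (hcA i)).2
  set τ := U.orderEmbOfFin hcard with hτ
  have hτU : ∀ i, τ i ∈ U := U.orderEmbOfFin_mem hcard
  set d : Fin (k + 1) → P := fun l => initialJoin a w (τ l) with hd
  have hdr : ∀ l, rank (d l) = τ l := fun l =>
    hw.independent.rank_initialJoin (hT _ (hUT _ (hτU l))).2.le
  obtain ⟨hdm, hdA⟩ := hw.independent.chain_mem hA hT (hw.independent.initialJoin_eq hu hw.le)
    τ.strictMono fun i => hUT _ (hτU i)
  obtain ⟨i₀, hi₀⟩ : t ∈ Set.range τ := by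
    rw [hτ, Finset.range_orderEmbOfFin]
    exact Finset.mem_insert_self _ _
  have hrem : i₀.removeNth d = c := by
    refine eq_of_strictMono_of_forall_exists (hdm.comp (Fin.strictMono_succAbove i₀)) hc fun j => ?_
    have hj := hτU (i₀.succAbove j)
    have hne : τ (i₀.succAbove j) ≠ t := fun h =>
      Fin.succAbove_ne i₀ j (τ.injective (h.trans hi₀.symm))
    rw [hU, Finset.mem_insert, Finset.mem_image] at hj
    obtain ⟨l, -, hl⟩ := hj.resolve_left hne
    exact ⟨l, by rw [Fin.removeNth_apply, hd, ← hwc l, hl]⟩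
  refine ⟨boundary 𝕜 P k (Finsupp.single d 1),
    Submodule.mem_map_of_mem (Finsupp.single_mem_supported _ _ ⟨hdm, hdA⟩), ?_, fun e hec he => ?_⟩
  · rw [← hrem, boundary_single_removeNth 𝕜 hdm.injective]
    exact pow_ne_zero _ (neg_ne_zero.2 one_ne_zero)
  · obtain ⟨j, rfl⟩ := boundary_single_ne_zero 𝕜 he
    refine ⟨⟨hdm.comp (Fin.strictMono_succAbove j), fun i => hdA _⟩, fun i => ?_, ?_⟩
    · rw [Fin.removeNth_apply, hdr]
    · have hne : i₀ ≠ j := by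
        rintro rfl
        exact hec hrem
      obtain ⟨l, hl⟩ := Fin.exists_succAbove_eq hne
      exact ⟨l, by rw [Fin.removeNth_apply, hl, hdr, hi₀]⟩

/-- The functional reads off, in the boundary, the coefficient of `c` without its element of rank
`t`. As `t` is not a descent, `w` is still least for this face, so no chain containing the face has
a smaller word. -/
theorem IsLeastWord.exists_functional (𝕜 : Type*) [Field 𝕜] (hu : rank u = n) {c : Fin k → P}
    (hw : IsLeastWord a u c w) (hc : StrictMono c) (hcn : ∀ i, rank (c i) ≤ n) {t : ℕ}
    (hd : ¬ IsDescent w t) (ht : ∃ i, rank (c i) = t) :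
    ∃ φ : Tuples 𝕜 P k →ₗ[𝕜] 𝕜, (∀ z ∈ cycles 𝕜 A k, φ z = 0) ∧ φ (Finsupp.single c 1) ≠ 0 ∧
      ∀ e, StrictMono e → φ (Finsupp.single e 1) ≠ 0 →
        ∀ v, IsLabelWord a u v → PassesThrough a v e → toLex w ≤ toLex v ∧
          (v = w → (∃ i, rank (e i) = t) → e = c) := by
  obtain ⟨i₀, hi₀⟩ := ht
  cases k with
  | zero => exact i₀.elim0
  | succ k =>
    refine ⟨(Finsupp.lapply (i₀.removeNth c)).comp (boundary 𝕜 P k), fun z hz => ?_, ?_, ?_⟩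
    · rw [LinearMap.comp_apply, LinearMap.mem_ker.1 hz.2, map_zero]
    · rw [LinearMap.comp_apply, Finsupp.lapply_apply, boundary_single_removeNth 𝕜 hc.injective]
      exact pow_ne_zero _ (neg_ne_zero.2 one_ne_zero)
    · intro e he hne v hv hve
      obtain ⟨j, hj⟩ := boundary_single_ne_zero 𝕜 hne
      have hce : ∀ l, c (i₀.succAbove l) = e (j.succAbove l) := fun l => congrFun hj l
      refine ⟨?_, ?_⟩
      · refine hw.isLabelWord.toLex_le hv
          (hw.isLabelWord.independent.initialJoin_eq hu hw.isLabelWord.le)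
          -- The ranks of `c` other than `t`; they still include all descents of `w`.
          (U := Set.range fun l => rank (c (i₀.succAbove l))) (fun s hs => ?_) ?_
        · obtain ⟨i, rfl⟩ := hw.exists_rank_eq hs hcn
          have hii : i ≠ i₀ := by
            rintro rfl
            exact hd (hi₀ ▸ hs)
          obtain ⟨l, rfl⟩ := Fin.exists_succAbove_eq hii
          exact ⟨l, rfl⟩
        · rintro _ ⟨l, rfl⟩ -
          simp only
          rw [hw.passesThrough, hce, hve]
      · rintro rfl ⟨i, hi⟩
        refine (eq_of_strictMono_of_forall_exists hc he fun l => ?_).symm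
        rcases eq_or_ne l i₀ with rfl | hl
        · exact ⟨i, by rw [← hw.passesThrough, ← hve, hi, hi₀]⟩
        · obtain ⟨l, rfl⟩ := Fin.exists_succAbove_eq hl
          exact ⟨_, hce l⟩

/-- The matching argument for both kinds of degrees: only the unmatched chains, whose least word is
a standard filling, need the extra elements of `B` supplied by `hlead`. -/
theorem cycles_le_of_leading [IsAtomistic P] {𝕜 : Type*} [Field 𝕜]
    (hA : ∀ x, x ∈ A ↔ x < u ∧ rank x ∈ T) (hT : ∀ t ∈ T, 0 < t ∧ t < n) (hu : rank u = n)
    (B : Submodule 𝕜 (Tuples 𝕜 P k)) (hB : boundaries 𝕜 A k ≤ B) (hB' : B ≤ cycles 𝕜 A k)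
    (hlead : ∀ (c : Fin k → P) (w : Fin n → Fin m), StrictMono c → (∀ i, c i ∈ A) →
      IsLeastWord a u c w → IsStandardFilling T w → ∃ b ∈ B, b c ≠ 0 ∧ ∀ e, e ≠ c → b e ≠ 0 →
        ∃ v, IsLabelWord a u v ∧ PassesThrough a v e ∧ toLex v < toLex w) :
    cycles 𝕜 A k ≤ B := by
  classical
  have hle : ∀ {c : Fin k → P}, (∀ i, c i ∈ A) → ∀ i, c i ≤ u := fun h i => ((hA _).1 (h i)).1.le
  have hrn : ∀ {c : Fin k → P}, (∀ i, c i ∈ A) → ∀ i, rank (c i) ≤ n := fun h i =>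
    hu ▸ rank_strictMono.monotone (hle h i)
  -- A default word for tuples that are not chains in `A`.
  obtain ⟨w₀, -⟩ := exists_isLeastWord a hu (c := (Fin.elim0 : Fin 0 → P)) (fun i => i.elim0)
    fun i => i.elim0
  have hω : ∀ c : Fin k → P, ∃ w : Fin n → Fin m, StrictMono c → (∀ i, c i ∈ A) →
      IsLeastWord a u c w := by
    intro c
    by_cases h : StrictMono c ∧ ∀ i, c i ∈ A
    · obtain ⟨w, hw⟩ := exists_isLeastWord a hu h.1 (hle h.2)
      exact ⟨w, fun _ _ => hw⟩
    · exact ⟨w₀, fun h₁ h₂ => absurd ⟨h₁, h₂⟩ h⟩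
  choose ω hω using hω
  have ht : ∀ w : Fin n → Fin m, ∃ t, IsLabelWord a u w → (∀ t, IsDescent w t → t ∈ T) →
      ¬ IsStandardFilling T w → t ∈ T ∧ ¬ IsDescent w t := by
    intro w
    by_cases h : IsLabelWord a u w ∧ (∀ t, IsDescent w t → t ∈ T) ∧ ¬ IsStandardFilling T w
    · obtain ⟨t, h₁, h₂⟩ := exists_not_isDescent h.1 h.2.1 h.2.2
      exact ⟨t, fun _ _ _ => ⟨h₁, h₂⟩⟩
    · exact ⟨0, fun h₁ h₂ h₃ => absurd ⟨h₁, h₂, h₃⟩ h⟩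
  choose t ht using ht
  -- Among chains with the same least word, those containing the chosen rank `t` come first, as
  -- `false < true`. The choice of `t` depends on the word alone.
  let key : (Fin k → P) → Lex (Fin n → Fin m) ×ₗ Bool := fun c =>
    toLex (toLex (ω c), decide (¬ ∃ i, rank (c i) = t (ω c)))
  have : Finite (Lex (Fin n → Fin m)) := Finite.of_equiv _ toLex
  have : Finite (Lex (Fin n → Fin m) ×ₗ Bool) := Finite.of_equiv _ toLex
  refine le_of_elimination {c | StrictMono c ∧ ∀ i, c i ∈ A} key _ B hB' (cycles_le_chains 𝕜 A k) ?_
  rintro c ⟨hc, hcA⟩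
  have hwc := hω c hc hcA
  have hdT : ∀ s, IsDescent (ω c) s → s ∈ T := by
    intro s hs
    obtain ⟨i, rfl⟩ := hwc.exists_rank_eq hs (hrn hcA)
    exact ((hA _).1 (hcA i)).2
  by_cases hst : IsStandardFilling T (ω c)
  · left
    obtain ⟨b, hbB, hbc, hbe⟩ := hlead c (ω c) hc hcA hwc hst
    refine ⟨b, hbB, hbc, fun e hec he => ?_⟩
    obtain ⟨heS, heA⟩ : e ∈ {c | StrictMono c ∧ ∀ i, c i ∈ A} :=
      (Finsupp.mem_supported _ _).1 (cycles_le_chains 𝕜 A k (hB' hbB))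
        (Finsupp.mem_support_iff.2 he)
    obtain ⟨v, hv, hve, hlt⟩ := hbe e hec he
    exact Prod.Lex.toLex_lt_toLex.2 (Or.inl (((hω e heS heA).toLex_le v hv hve).trans_lt hlt))
  obtain ⟨htT, htd⟩ := ht _ hwc.isLabelWord hdT hst
  by_cases htc : ∃ i, rank (c i) = t (ω c)
  · right
    obtain ⟨φ, hφ, hφc, hφe⟩ := hwc.exists_functional (A := A) 𝕜 hu hc (hrn hcA) htd htc
    refine ⟨φ, hφ, hφc, ?_⟩
    rintro e ⟨heS, heA⟩ hec hkey
    by_contra hne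
    have hwe := hω e heS heA
    obtain ⟨h₁, h₂⟩ := hφe e heS hne _ hwe.isLabelWord hwe.passesThrough
    rcases Prod.Lex.toLex_le_toLex.1 hkey with h | ⟨h, h'⟩
    · exact absurd h (not_lt.2 h₁)
    · have hωe : ω e = ω c := toLex.injective h
      refine hec (h₂ hωe ?_)
      by_contra hex
      simp only [hωe] at h'
      rw [decide_eq_true hex, decide_eq_false (not_not.2 htc)] at h'
      exact absurd h' (by decide)
  · left
    obtain ⟨b, hbB, hbc, hbe⟩ := exists_boundary_leading 𝕜 hA hT hu hwc.isLabelWord hc hcA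
      hwc.passesThrough htT (not_exists.1 htc)
    refine ⟨b, hB hbB, hbc, fun e hec he => ?_⟩
    obtain ⟨⟨heS, heA⟩, hwe, hte⟩ := hbe e hec he
    refine Prod.Lex.toLex_lt_toLex.2 ?_
    rcases ((hω e heS heA).toLex_le _ hwc.isLabelWord hwe).lt_or_eq with h | h
    · exact Or.inl h
    · have hωe : ω e = ω c := toLex.injective h
      refine Or.inr ⟨h, ?_⟩
      simp only [hωe]
      rw [decide_eq_true htc, decide_eq_false (not_not.2 hte)]
      decide

/-- Every element of `T` is a descent of a standard filling, and descents of the least word are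
ranks of `c`. -/
theorem IsLeastWord.image_rank_eq (hA : ∀ x, x ∈ A ↔ x < u ∧ rank x ∈ T)
    (hT : ∀ t ∈ T, 0 < t ∧ t < n) (hu : rank u = n) {c : Fin k → P}
    (hcA : ∀ i, c i ∈ A) (hw : IsLeastWord a u c w) (hs : IsStandardFilling T w) :
    Finset.univ.image (fun i => rank (c i)) = T := by
  refine Finset.Subset.antisymm ?_ fun t ht => ?_
  · intro s hs
    obtain ⟨i, -, rfl⟩ := Finset.mem_image.1 hs
    exact ((hA _).1 (hcA i)).2
  · have hd : IsDescent w t := by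
      obtain ⟨h₀, h₁⟩ := hT t ht
      refine ⟨⟨t - 1, by omega⟩, ⟨t, h₁⟩, by simp only; omega, rfl, ?_⟩
      exact ((isStandardFilling_iff hw.isLabelWord.independent.injective).1 hs _ _
        (by simp only; omega)).1 ht
    obtain ⟨i, hi⟩ := hw.exists_rank_eq hd fun i =>
      hu ▸ rank_strictMono.monotone ((hA _).1 (hcA i)).1.le
    exact Finset.mem_image.2 ⟨i, Finset.mem_univ _, hi⟩

end Homology

/-! ### Ribbon bases -/

section Bases

theorem chains_eq_bot {𝕜 : Type*} [Field 𝕜] {P : Type*} [PartialOrder P] [Finite P] {k : ℕ} {u : P}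
    {T : Finset ℕ} {A : Set P} (hA : ∀ x, x ∈ A ↔ x < u ∧ rank x ∈ T)
    (hk : T.card < k) : chains 𝕜 A k = ⊥ := by
  rw [chains, ← Finsupp.supported_empty]
  congr 1
  refine Set.eq_empty_of_forall_notMem ?_
  rintro c ⟨hc, hcA⟩
  have hsub : Finset.univ.map ⟨fun i => rank (c i), (rank_strictMono.comp hc).injective⟩ ⊆ T := by
    intro t ht
    obtain ⟨i, -, rfl⟩ := Finset.mem_map.1 ht
    exact ((hA _).1 (hcA i)).2
  have := Finset.card_le_card hsub
  rw [Finset.card_map, Finset.card_univ, Fintype.card_fin] at this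
  omega

theorem boundaries_card_eq_bot (𝕜 : Type*) [Field 𝕜] {P : Type*} [PartialOrder P] [Finite P]
    {u : P} {T : Finset ℕ} {A : Set P} (hA : ∀ x, x ∈ A ↔ x < u ∧ rank x ∈ T) :
    boundaries 𝕜 A T.card = ⊥ := by
  rw [boundaries, chains_eq_bot hA (Nat.lt_succ_self _), Submodule.map_bot]

variable {P : Type*} [Lattice P] [BoundedOrder P] [Finite P] [IsWeakUpperModularLattice P]
  {m n k : ℕ} {a : Fin m ≃ {x : P // IsAtom x}} {u : P} {T : Finset ℕ} {A : Set P}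

theorem cycles_le_boundaries [IsAtomistic P] (𝕜 : Type*) [Field 𝕜]
    (a : Fin m ≃ {x : P // IsAtom x}) (hA : ∀ x, x ∈ A ↔ x < u ∧ rank x ∈ T)
    (hT : ∀ t ∈ T, 0 < t ∧ t < n) (hu : rank u = n) (hk : k ≠ T.card) :
    cycles 𝕜 A k ≤ boundaries 𝕜 A k := by
  refine cycles_le_of_leading (a := a) hA hT hu _ le_rfl (boundaries_le_cycles 𝕜 A k) ?_
  intro c w hc hcA hw hs
  -- An unmatched chain would have exactly `#T` elements.
  refine absurd ?_ hk
  have hinj : Function.Injective fun i => rank (c i) := (rank_strictMono.comp hc).injective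
  rw [← hw.image_rank_eq hA hT hu hcA hs, Finset.card_image_of_injective _ hinj,
    Finset.card_univ, Fintype.card_fin]

theorem cycles_eq_span [IsAtomistic P] (𝕜 : Type*) [Field 𝕜]
    (hA : ∀ x, x ∈ A ↔ x < u ∧ rank x ∈ T) (hT : ∀ t ∈ T, 0 < t ∧ t < n) (hu : rank u = n) :
    cycles 𝕜 A T.card = Submodule.span 𝕜 (Set.range
      fun F : {w : Fin n → Fin m // IsLabelWord a u w ∧ IsStandardFilling T w} =>
        ribbonElement 𝕜 a T F.1) := by
  have hle : Submodule.span 𝕜 (Set.range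
      fun F : {w : Fin n → Fin m // IsLabelWord a u w ∧ IsStandardFilling T w} =>
        ribbonElement 𝕜 a T F.1) ≤ cycles 𝕜 A T.card := by
    rw [Submodule.span_le]
    rintro _ ⟨F, rfl⟩
    exact ribbonElement_mem_cycles 𝕜 hA hT F.2.1.independent
      (F.2.1.independent.initialJoin_eq hu F.2.1.le)
  refine le_antisymm (cycles_le_of_leading (a := a) hA hT hu _ ?_ hle ?_) hle
  · rw [boundaries_card_eq_bot 𝕜 hA]
    exact bot_le
  · intro c w hc hcA hw hs
    -- The ranks of `c` lie in `T` and there are `#T` of them, so `c` is the whole `T`-selected part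
    -- of the maximal chain of `w`.
    have hcw : c = fun l => initialJoin a w (T.orderEmbOfFin rfl l) := by
      refine eq_of_strictMono_of_forall_exists hc
        (hw.isLabelWord.independent.chain_mem hA hT
          (hw.isLabelWord.independent.initialJoin_eq hu hw.isLabelWord.le)
          (T.orderEmbOfFin rfl).strictMono (T.orderEmbOfFin_mem rfl)).1 fun i => ?_
      obtain ⟨l, hl⟩ : rank (c i) ∈ Set.range (T.orderEmbOfFin rfl) := by
        rw [Finset.range_orderEmbOfFin]
        exact ((hA _).1 (hcA i)).2
      exact ⟨l, by rw [hl, hw.passesThrough]⟩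
    refine ⟨ribbonElement 𝕜 a T w, Submodule.subset_span ⟨⟨w, hw.isLabelWord, hs⟩, rfl⟩, ?_, ?_⟩
    · rw [hcw, ribbonElement_leading hT hu hw.isLabelWord hs]
      exact one_ne_zero
    · intro e hec he
      obtain ⟨σ, hσ, rfl⟩ :=
        exists_of_ribbonElement_ne_zero (fun h0 => absurd (hT 0 h0).1 (lt_irrefl _)) he
      obtain ⟨v, hv, hve, -, hlt⟩ := hw.isLabelWord.exists_passesThrough hT hs hσ
      refine ⟨v, hv, hve, hlt ?_⟩
      rintro rfl
      exact hec hcw.symm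

/-- Triangularity in the lexicographic order: if the leading chain of `G` occurs in the element of
`F`, then a word at most `F` passes through it, while `G` is the least such word. -/
theorem linearIndependent_ribbonElement (𝕜 : Type*) [Field 𝕜] (hT : ∀ t ∈ T, 0 < t ∧ t < n)
    (hu : rank u = n) : LinearIndependent 𝕜
      fun F : {w : Fin n → Fin m // IsLabelWord a u w ∧ IsStandardFilling T w} =>
        ribbonElement 𝕜 a T F.1 := by
  let _ : LinearOrder {w : Fin n → Fin m // IsLabelWord a u w ∧ IsStandardFilling T w} :=
    LinearOrder.lift' (fun F => toLex F.1) (toLex.injective.comp Subtype.val_injective)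
  refine linearIndependent_of_leading _
    (fun F l => initialJoin a F.1 (T.orderEmbOfFin rfl l)) (fun F => ?_) fun F G h => ?_
  · rw [ribbonElement_leading hT hu F.2.1 F.2.2]
    exact one_ne_zero
  · obtain ⟨σ, hσ, he⟩ :=
      exists_of_ribbonElement_ne_zero (fun h0 => absurd (hT 0 h0).1 (lt_irrefl _)) h
    obtain ⟨v, hv, hve, hle, -⟩ := F.2.1.exists_passesThrough hT F.2.2 hσ
    exact ((G.2.2.isLeastWord hT hu G.2.1).toLex_le v hv (he ▸ hve)).trans hle

theorem exists_basis_reducedHomology [IsAtomistic P] (𝕜 : Type*) [Field 𝕜]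
    (hA : ∀ x, x ∈ A ↔ x < u ∧ rank x ∈ T) (hT : ∀ t ∈ T, 0 < t ∧ t < rank u)
    (hF : ∀ F : StandardNBCPlusFilling a T u, ribbonElement 𝕜 a T F.1 ∈ cycles 𝕜 A T.card) :
    ∃ b : Module.Basis (StandardNBCPlusFilling a T u) 𝕜 (ReducedHomology 𝕜 A T.card),
      ∀ F, b F = homologyClass (ribbonElement 𝕜 a T F.1) (hF F) := by
  let f : StandardNBCPlusFilling a T u ≃
      {w : Fin (rank u) → Fin m // IsLabelWord a u w ∧ IsStandardFilling T w} :=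
    Equiv.subtypeEquivRight fun w => by rw [isNBCPlusBasis_iff]
  -- There are no nonzero boundaries in this degree, so cycles and homology classes agree.
  have hinj : Function.Injective
      ((boundaries 𝕜 A T.card).mkQ.submoduleMap (cycles 𝕜 A T.card)) := by
    refine (injective_iff_map_eq_zero _).2 ?_
    rintro ⟨z, hz⟩ h
    have h : (boundaries 𝕜 A T.card).mkQ z = 0 := congrArg Subtype.val h
    rw [Submodule.mkQ_apply, Submodule.Quotient.mk_eq_zero, boundaries_card_eq_bot 𝕜 hA,
      Submodule.mem_bot] at h
    exact Subtype.ext h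
  let e := LinearEquiv.ofBijective _
    ⟨hinj, LinearMap.submoduleMap_surjective (boundaries 𝕜 A T.card).mkQ (cycles 𝕜 A T.card)⟩
  let b₀ := (Module.Basis.span (linearIndependent_ribbonElement (a := a) 𝕜 hT rfl)).map
    (LinearEquiv.ofEq _ _ (cycles_eq_span (a := a) 𝕜 hA hT rfl).symm)
  refine ⟨(b₀.map e).reindex f.symm, fun F => ?_⟩
  rw [Module.Basis.reindex_apply, Module.Basis.map_apply, Equiv.symm_symm]
  have : b₀ (f F) = ⟨ribbonElement 𝕜 a T F.1, hF F⟩ := by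
    refine Subtype.ext ?_
    simp only [b₀, Module.Basis.map_apply, LinearEquiv.coe_ofEq_apply, Module.Basis.span_apply]
    rfl
  rw [this]
  rfl

end Bases

/-! ### Bases of direct sums and the final assembly -/

theorem exists_basis_directSum_of_component {𝕜 ι η : Type*} [Field 𝕜] [DecidableEq ι]
    {M : ι → Type*} [∀ i, AddCommGroup (M i)] [∀ i, Module 𝕜 (M i)] (i : ι)
    (h : ∀ j, j ≠ i → Subsingleton (M j)) (b : Module.Basis η 𝕜 (M i)) :
    ∃ b' : Module.Basis η 𝕜 (⨁ j, M j), ∀ x, b' x = DirectSum.lof 𝕜 ι M i (b x) := by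
  have hbij : Function.Bijective (DirectSum.lof 𝕜 ι M i) := by
    refine ⟨DirectSum.of_injective i, fun z => ⟨z i, ?_⟩⟩
    refine DFinsupp.ext fun j => ?_
    rcases eq_or_ne j i with rfl | hj
    · exact DirectSum.lof_apply 𝕜 j (z j)
    · exact (h j hj).elim _ _
  exact ⟨b.map (LinearEquiv.ofBijective _ hbij), fun x => rfl⟩

theorem exists_basis_directSum {𝕜 ι : Type*} [Semiring 𝕜] [DecidableEq ι] {η : ι → Type*}
    {M : ι → Type*} [∀ i, AddCommMonoid (M i)] [∀ i, Module 𝕜 (M i)]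
    (b : ∀ i, Module.Basis (η i) 𝕜 (M i)) :
    ∃ b' : Module.Basis (Σ i, η i) 𝕜 (⨁ i, M i),
      ∀ i x, b' ⟨i, x⟩ = DirectSum.lof 𝕜 ι M i (b i x) := by
  refine ⟨DFinsupp.basis b, fun i x => ?_⟩
  rw [Module.Basis.apply_eq_iff]
  classical
  change sigmaFinsuppEquivDFinsupp.symm (DFinsupp.mapRange (fun i => (b i).repr)
    (fun i => map_zero (b i).repr) (DFinsupp.single i (b i x))) = _
  rw [DFinsupp.mapRange_single, Equiv.symm_apply_eq]
  simp

end RibbonBasis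

open RibbonBasis

theorem mainTheorem3 {P : Type*} [Lattice P] [BoundedOrder P] [Finite P]
    [IsWeakUpperModularLattice P] [IsAtomistic P]
    {m : ℕ} (a : Fin m ≃ {x : P // IsAtom x})
    (S : Finset ℕ) (hS : S.Nonempty) (hS' : ∀ s ∈ S, 1 ≤ s ∧ s < rank (⊤ : P)) :
    ∃ hcycle : ∀ (u : TopElements P S hS)
        (F : StandardNBCPlusFilling a (S.erase (S.max' hS)) u.1),
        ribbonElement ℂ a (S.erase (S.max' hS)) F.1 ∈
          cycles ℂ (openInterval S u.1) (S.erase (S.max' hS)).card,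
      ∃ b : Module.Basis
          (Σ u : TopElements P S hS, StandardNBCPlusFilling a (S.erase (S.max' hS)) u.1)
          ℂ (WhitneyHomology ℂ P S hS),
        ∀ (u : TopElements P S hS) (F : StandardNBCPlusFilling a (S.erase (S.max' hS)) u.1),
          b ⟨u, F⟩ = whitneyClass S hS u (S.erase (S.max' hS)).card
            (ribbonElement ℂ a (S.erase (S.max' hS)) F.1) (hcycle u F) := by
  classical
  set T := S.erase (S.max' hS) with hTdef
  have hT : ∀ u : TopElements P S hS, ∀ t ∈ T, 0 < t ∧ t < rank u.1 := by
    intro u t ht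
    rw [u.2]
    exact ⟨(hS' t (Finset.mem_of_mem_erase ht)).1,
      lt_of_le_of_ne (S.le_max' t (Finset.mem_of_mem_erase ht)) (Finset.ne_of_mem_erase ht)⟩
  -- Below `u` the rank `max S` cannot occur, and ranks in `T` are positive, so neither removing
  -- `max S` nor dropping `⊥ < x` changes the interval.
  have hA : ∀ u : TopElements P S hS, ∀ x, x ∈ openInterval S u.1 ↔ x < u.1 ∧ rank x ∈ T := by
    intro u x
    constructor
    · rintro ⟨-, hxu, hx⟩
      exact ⟨hxu, Finset.mem_erase.2 ⟨u.2 ▸ (rank_strictMono hxu).ne, hx⟩⟩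
    · rintro ⟨hxu, hx⟩
      refine ⟨bot_lt_iff_ne_bot.2 ?_, hxu, Finset.mem_of_mem_erase hx⟩
      rintro rfl
      exact absurd (hT u _ hx).1 (by simp)
  have hcycle : ∀ (u : TopElements P S hS) (F : StandardNBCPlusFilling a T u.1),
      ribbonElement ℂ a T F.1 ∈ cycles ℂ (openInterval S u.1) T.card := fun u F =>
    have hF := isNBCPlusBasis_iff.1 F.2.1
    ribbonElement_mem_cycles ℂ (hA u) (hT u) hF.independent
      (hF.independent.initialJoin_eq rfl hF.le)
  refine ⟨hcycle, ?_⟩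
  have hbasis : ∀ u : TopElements P S hS, ∃ b : Module.Basis (StandardNBCPlusFilling a T u.1) ℂ
      (⨁ k : ℕ, ReducedHomology ℂ (openInterval S u.1) k), ∀ F, b F =
        DirectSum.lof ℂ ℕ (fun k => ReducedHomology ℂ (openInterval S u.1) k) T.card
          (homologyClass (ribbonElement ℂ a T F.1) (hcycle u F)) := by
    intro u
    obtain ⟨b, hb⟩ := exists_basis_reducedHomology ℂ (hA u) (hT u) (hcycle u)
    obtain ⟨b', hb'⟩ := exists_basis_directSum_of_component
      (M := fun k => ReducedHomology ℂ (openInterval S u.1) k) T.card (fun k hk => by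
        rw [Submodule.subsingleton_iff_eq_bot, eq_bot_iff, Submodule.map_le_iff_le_comap,
          ← LinearMap.ker, Submodule.ker_mkQ]
        exact cycles_le_boundaries ℂ a (hA u) (hT u) rfl hk) b
    exact ⟨b', fun F => by rw [hb', hb]⟩
  choose b hb using hbasis
  obtain ⟨b', hb'⟩ := exists_basis_directSum
    (M := fun u : TopElements P S hS => ⨁ k : ℕ, ReducedHomology ℂ (openInterval S u.1) k) b
  refine ⟨b', fun u F => ?_⟩
  rw [hb', hb, whitneyClass]
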